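/- Let $\kappa\ge 2$, and let $\sigma^x_c,\sigma^y_c,\sigma^z_c$ be the Pauli operators on the qubits $c\in\{0,\dots,\kappa-1\}$ of a ring (indices modulo $\kappa$). Put $$H_{XY,\mathrm{ring}}=\tfrac12\sum_{c}\big(\sigma^x_c\sigma^x_{c+1}+\sigma^y_c\sigma^y_{c+1}\big),\qquad G=\prod_c\sigma^z_c,\qquad a_c=\Big(\prod_{d<c}\sigma^z_d\Big)\frac{\sigma^x_c+i\sigma^y_c}{2}\quad\text{(Jordan–Wigner)},$$ $$f_k=\frac1{\sqrt\kappa}\sum_c e^{-2\pi i ck/\kappa}a_c,\qquad E_k=2\cos(2\pi k/\kappa),\qquad b_c=\frac1{\sqrt\kappa}\sum_k e^{2\pi i ck/\kappa}a_k .$$ Let $\mathrm{FFFT}$ be the linear operator on $(\mathbb C^2)^{\otimes\kappa}$ with $a_{c_1}^\dagger\cdots a_{c_N}^\dagger|0\cdots0\rangle\mapsto b_{c_1}^\dagger\cdots b_{c_N}^\dagger|0\cdots0\rangle$ for all $c_1<\dots<c_N$. The *odd sector* is the eigenspace $G=-1$ (spanned by bit strings of odd Hamming weight); it contains the *feasible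 subspace*, spanned by the bit strings of Hamming weight one. **(1) Exact diagonalization.** For every $\kappa\ge2$: - The $a_c$ satisfy the canonical anticommutation relations, $a_c^\dagger a_c=(1-\sigma^z_c)/2$, and $$H_{XY,\mathrm{ring}}=\sum_{c=0}^{\kappa-2}\big(a_c^\dagger a_{c+1}+\mathrm{h.c.}\big)-\big(a_{\kappa-1}^\dagger a_0\,G+\mathrm{h.c.}\big).$$ Hence on the odd sector $H_{XY,\mathrm{ring}}$ coincides with the periodic quadratic Hamiltonian $H_F=\sum_{c}(a_c^\dagger a_{c+1}+\mathrm{h.c.})$, the sum now being over the whole ring. - The $f_k$ satisfy the canonical anticommutation relations, and $H_F=\sum_k E_k f_k^\dagger f_k$. - $\mathrm{FFFT}$ is unitary, fixes $|0\cdots0\rangle$, and satisfies $\mathrm{FFFT}^\dagger a_k\,\mathrm{FFFT}=f_k$ for all $k$ and $\mathrm{FFFT}\,H_F\,\mathrm{FFFT}^\dagger=\sum_k E_k(1-\sigma^z_k)/2$. - For every $\beta\in\mathbb R$, $$e^{-i\beta H_F}=\mathrm{FFFT}^\dagger\Big(\prod_k e^{-i\beta E_k(1-\sigma^z_k)/2}\Big)\mathrm{FFFT},$$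 and on the odd sector $e^{-i\beta H_{XY,\mathrm{ring}}}$ equals the same product. **(2) Logarithmic depth.** Consider circuits with all-to-all connectivity, each layer of which consists of gates on pairwise disjoint sets of qubits; the depth is the number of layers. The gates are single-qubit $Z$ rotations $e^{-i\theta(1-\sigma^z_j)/2}$ and, for arbitrary $i\ne j$ and $\theta\in\mathbb R$, interactions between $i$ and $j$. The latter are read either as two-qubit gates $e^{-i\theta(\sigma^x_i\sigma^x_j+\sigma^y_i\sigma^y_j)/2}$ or as two-mode fermionic gates $e^{-i\theta(a_i^\dagger a_j+a_j^\dagger a_i)}$. There is a constant $C$ such that for every $\kappa=2^m$, $m\ge1$, there is such a circuit $W$ of depth at most $C\log\kappa$ that equals $\mathrm{FFFT}$ on the whole space when read with two-mode fermionic gates, and equals $\mathrm{FFFT}$ on the feasible subspace when read with two-qubit gates. Moreover, for every $\beta\in\mathbb R$ the circuit "$W$, then one layer of $Z$ rotations by the angles $\beta E_k$, then $W^\dagger$" also has depth at most $C\log\kappa$, and it equals $e^{-i\beta H_{XY,\mathrm{ring}}}$ exactly: on the odd sector when read with two-mode fermionic gates, and on the feasible subspace when read with two-qubit gates. -/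

import Mathlib

open Matrix Complex

namespace XYRing

noncomputable section

/-! ### Qubits and Pauli operators

The computational basis of `κ` qubits is indexed by bit strings `Fin κ → Fin 2`; states are
vectors in `(Fin κ → Fin 2) → ℂ` and operators are matrices (rows are outputs). -/

/-- Operators on the Hilbert space of `κ` qubits. -/
abbrev Op (κ : ℕ) : Type := Matrix (Fin κ → Fin 2) (Fin κ → Fin 2) ℂ

/-- State vectors of `κ` qubits. -/
abbrev State (κ : ℕ) : Type := (Fin κ → Fin 2) → ℂ

/-- The `2 × 2` matrix `A` acting on qubit `c`, tensored with the identity on all others. -/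
def onQubit {κ : ℕ} (c : Fin κ) (A : Matrix (Fin 2) (Fin 2) ℂ) : Op κ :=
  Matrix.of fun x y => if ∀ d, d ≠ c → x d = y d then A (x c) (y c) else 0

/-- The Pauli operator `σˣ` on qubit `c`. -/
def pauliX {κ : ℕ} (c : Fin κ) : Op κ := onQubit c !![0, 1; 1, 0]

/-- The Pauli operator `σʸ` on qubit `c`. -/
def pauliY {κ : ℕ} (c : Fin κ) : Op κ := onQubit c !![0, -I; I, 0]

/-- The Pauli operator `σᶻ` on qubit `c`. -/
def pauliZ {κ : ℕ} (c : Fin κ) : Op κ := onQubit c !![1, 0; 0, -1]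

/-- The qubit operator `(1 - σᶻ)/2`, with value `0` on `|0⟩` and `1` on `|1⟩`. -/
def occupation {κ : ℕ} (c : Fin κ) : Op κ := (1 / 2 : ℂ) • (1 - pauliZ c)

/-- The number of ones in a bit string. -/
def hammingWeight {κ : ℕ} (x : Fin κ → Fin 2) : ℕ :=
  (Finset.univ.filter fun c => x c = 1).card

/-- The successor of a site on the ring, with periodic boundary condition. -/
def next {κ : ℕ} (c : Fin κ) : Fin κ := ⟨((c : ℕ) + 1) % κ, Nat.mod_lt _ c.pos⟩

/-- The `XY` interaction `σˣσˣ + σʸσʸ` between two qubits. -/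
def xyPair {κ : ℕ} (c d : Fin κ) : Op κ := pauliX c * pauliX d + pauliY c * pauliY d

/-- The `XY` Hamiltonian on the ring,
`H = (1/2) ∑_c (σˣ_c σˣ_{c+1} + σʸ_c σʸ_{c+1})` with periodic boundary condition. -/
def xyRing (κ : ℕ) : Op κ := (1 / 2 : ℂ) • ∑ c : Fin κ, xyPair c (next c)

/-- The gauge (parity) operator `∏_c σᶻ_c = (-1)^(number of ones)`. -/
def parity (κ : ℕ) : Op κ := Matrix.diagonal fun x => (-1 : ℂ) ^ hammingWeight x

/-- The sector of odd Hamming weight (odd particle number): the `-1` eigenspace of the parity. -/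
def IsOdd {κ : ℕ} (ψ : State κ) : Prop := parity κ *ᵥ ψ = -ψ

/-- The feasible subspace of the one-hot encoding, spanned by the bit strings of Hamming
weight one. -/
def IsFeasible {κ : ℕ} (ψ : State κ) : Prop := ∀ x, ψ x ≠ 0 → hammingWeight x = 1

/-! ### Fermions -/

/-- The Jordan–Wigner string `∏_{d < c} σᶻ_d`: it multiplies a basis state by `-1` to the number
of ones strictly before `c`. -/
def jwString {κ : ℕ} (c : Fin κ) : Op κ :=
  Matrix.diagonal fun x => (-1 : ℂ) ^ (Finset.univ.filter fun d => d < c ∧ x d = 1).card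

/-- The Jordan–Wigner fermionic annihilation operator
`a_c = (∏_{d < c} σᶻ_d) (σˣ_c + i σʸ_c) / 2`; its adjoint is the creation operator. -/
def ann {κ : ℕ} (c : Fin κ) : Op κ :=
  jwString c * ((1 / 2 : ℂ) • (pauliX c + I • pauliY c))

/-- The canonical anticommutation relations. -/
def IsCAR {κ : ℕ} (a : Fin κ → Op κ) : Prop :=
  (∀ c d, a c * (a d)ᴴ + (a d)ᴴ * a c = if c = d then 1 else 0) ∧
  (∀ c d, a c * a d + a d * a c = 0)

/-- Hopping between two fermionic modes, `a_c† a_d + h.c.` -/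
def hop {κ : ℕ} (c d : Fin κ) : Op κ := (ann c)ᴴ * ann d + (ann d)ᴴ * ann c

/-- The quadratic fermionic Hamiltonian `∑_c (a_c† a_{c+1} + h.c.)` on the periodic ring. -/
def fermionRing (κ : ℕ) : Op κ := ∑ c : Fin κ, hop c (next c)

/-- The vacuum `|0…0⟩`. -/
def vacuum (κ : ℕ) : State κ := fun x => if x = 0 then 1 else 0

/-- The momentum modes `f_k = κ^(-1/2) ∑_c e^{-2πi ck/κ} a_c`. -/
def mode {κ : ℕ} (k : Fin κ) : Op κ :=
  ((1 / Real.sqrt κ : ℝ) : ℂ) •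
    ∑ c : Fin κ, Complex.exp (-(2 * Real.pi * I * (c : ℕ) * (k : ℕ) / κ)) • ann c

/-- The operators `b_c = κ^(-1/2) ∑_k e^{2πi ck/κ} a_k`, to which the fermionic Fourier transform
sends `a_c`. -/
def image {κ : ℕ} (c : Fin κ) : Op κ :=
  ((1 / Real.sqrt κ : ℝ) : ℂ) •
    ∑ k : Fin κ, Complex.exp (2 * Real.pi * I * (c : ℕ) * (k : ℕ) / κ) • ann k

/-- The fermionic Fourier transform on the whole Fock space: the basis state
`|x⟩ = a_{c₁}† ⋯ a_{c_N}† |0…0⟩` with ones at `c₁ < ⋯ < c_N` is sent to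
`b_{c₁}† ⋯ b_{c_N}† |0…0⟩`. -/
def FFFT (κ : ℕ) : Op κ :=
  Matrix.of fun y x =>
    ((((List.finRange κ).filter fun c => x c = 1).map fun c => (image c)ᴴ).prod *ᵥ vacuum κ) y

/-- The single-particle energies `E_k = 2 cos (2πk/κ)`. -/
def energy {κ : ℕ} (k : Fin κ) : ℝ := 2 * Real.cos (2 * Real.pi * (k : ℕ) / κ)

/-- The time evolution `exp (-i t H)`. -/
def evolve {κ : ℕ} (t : ℝ) (H : Op κ) : Op κ := NormedSpace.exp ((-(I * (t : ℂ))) • H)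

/-! ### Circuits with all-to-all connectivity -/

/-- Gates: a rotation about the `Z` axis of any single qubit, and an `XY` (hopping) interaction
between any two qubits (modes). -/
inductive Gate (κ : ℕ) : Type
  | rot (j : Fin κ) (θ : ℝ)
  | xy (i j : Fin κ) (θ : ℝ)

/-- The qubits on which a gate acts. -/
def Gate.qubits {κ : ℕ} : Gate κ → List (Fin κ)
  | .rot j _ => [j]
  | .xy i j _ => [i, j]

/-- The inverse gate. -/
def Gate.dagger {κ : ℕ} : Gate κ → Gate κ
  | .rot j θ => .rot j (-θ)
  | .xy i j θ => .xy i j (-θ)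

/-- The gate as an operator on qubits: `exp (-iθ (1 - σᶻ_j)/2)`, and the two-qubit gate
`exp (-iθ (σˣ_i σˣ_j + σʸ_i σʸ_j)/2)`. -/
def Gate.qubitOp {κ : ℕ} : Gate κ → Op κ
  | .rot j θ => evolve θ (occupation j)
  | .xy i j θ => evolve θ ((1 / 2 : ℂ) • xyPair i j)

/-- The gate as an operator on fermionic modes: `exp (-iθ a_j† a_j)`, and the two-mode gate
`exp (-iθ (a_i† a_j + h.c.))`. -/
def Gate.fermionOp {κ : ℕ} : Gate κ → Op κ
  | .rot j θ => evolve θ ((ann j)ᴴ * ann j)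
  | .xy i j θ => evolve θ (hop i j)

/-- A circuit is a sequence of layers, the first one being applied first; its depth is the number
of layers. -/
abbrev Circuit (κ : ℕ) : Type := List (List (Gate κ))

/-- In every layer the gates act on distinct qubits, so that they can be executed in parallel
(in particular the two qubits of an `xy` gate are distinct). -/
def Circuit.Valid {κ : ℕ} (W : Circuit κ) : Prop :=
  ∀ L ∈ W, (L.flatMap Gate.qubits).Nodup

/-- The depth of a circuit. -/
def Circuit.depth {κ : ℕ} (W : Circuit κ) : ℕ := W.length

/-- The inverse circuit: inverse gates, in the reverse order of layers. -/
def Circuit.dagger {κ : ℕ} (W : Circuit κ) : Circuit κ :=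
  (W.map fun L => L.map Gate.dagger).reverse

/-- The operator that a circuit implements, when every gate is read as an operator by `f`. -/
def Circuit.eval {κ : ℕ} (f : Gate κ → Op κ) (W : Circuit κ) : Op κ :=
  (W.map fun L => (L.map f).prod).reverse.prod

/-- One layer of single-qubit `Z` rotations, by the angle `β E_k` on qubit `k`. -/
def rotLayer (κ : ℕ) (β : ℝ) : List (Gate κ) :=
  (List.finRange κ).map fun k => Gate.rot k (β * energy k)

/-- The mixer circuit: `W`, then one layer of `Z` rotations, then the inverse of `W`. -/
def mixer {κ : ℕ} (W : Circuit κ) (β : ℝ) : Circuit κ :=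
  W ++ [rotLayer κ β] ++ Circuit.dagger W

end

end XYRing

open XYRing

/-!
Write `a_c = J_c s_c` with the Jordan–Wigner string `J_c` and the spin lowering operator `s_c`. The
anticommutation relations and the fermionic form of the ring follow from the signs that arise when
strings and lowering operators are interchanged. The string of the boundary term is the parity, so
that the `XY` ring and the periodic fermionic ring agree after multiplication by `1 - G`
(`xyRing_mul_eq_fermionRing_mul`). Plane waves diagonalize the translation by one site
(`sum_annDag_mul_ann_next`), which gives `H_F = ∑ E_k f_k† f_k`.

For any family `b` of fermionic operators that annihilate the vacuum, moving `b_c` to the right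
through `b_{c₁}† ⋯ b_{c_N}† |0⟩` yields an expansion with coefficients that do not depend on the
family (`mulVec_fockState`). Therefore the Gram matrices of the Fock states of `a` and `b` agree
(`gram_eq`), which makes `FFFT` unitary, and `FFFT` intertwines `a_c` with `b_c` (`FFFT_mul_ann`).
All exponentials are handled by one principle: an intertwiner of two Hamiltonians intertwines their
evolutions (`evolve_semiconj`). It gives the evolution in the odd sector and the action of the gates
on creation operators.

A circuit of fermionic gates fixes the vacuum and acts linearly on creation operators. So it is
`FFFT` on the whole Fock space as soon as its action on a single particle is the discrete Fourier
transform (`Circuit.eval_eq_FFFT`). For `κ = 2 ^ m` this action is realized by the radix-two fast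
Fourier transform: `m` butterfly stages of three layers each, where a balanced beam splitter between
phases is a Hadamard matrix, and a final reversal of the bits by swaps. After the stages from the
highest bit down to bit `t`, the amplitude is the product formula `fftAmp t`; one more stage
transforms one more factor (`act_fftStage_fftAmp`).

Gates on disjoint sets of modes commute, hence the inverse circuit implements the adjoint
(`Circuit.eval_fermionOp_dagger`). On the feasible subspace the strings act trivially, so that the
two readings of a circuit agree there (`Circuit.eval_qubitOp_mul_feasibleProj`).
-/

open XYRing

namespace XYRing

noncomputable section

variable {κ : ℕ}

/-! ### Single-qubit operators -/

lemma onQubit_apply (c : Fin κ) (A : Matrix (Fin 2) (Fin 2) ℂ) (x y : Fin κ → Fin 2) :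
    onQubit c A x y = ∑ b, if y = Function.update x c b then A (x c) b else 0 := by
  have key : ∀ b, y = Function.update x c b ↔ (∀ d, d ≠ c → x d = y d) ∧ b = y c := by
    intro b
    rw [Function.eq_update_iff]
    exact ⟨fun h => ⟨fun d hd => (h.2 d hd).symm, h.1.symm⟩,
      fun h => ⟨h.2.symm, fun d hd => (h.1 d hd).symm⟩⟩
  simp only [key, onQubit, Matrix.of_apply]
  split_ifs with h
  · simp [and_iff_right h]
  · simp [-ne_eq, h]

lemma onQubit_mul_apply (c : Fin κ) (A : Matrix (Fin 2) (Fin 2) ℂ) (M : Op κ)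
    (x y : Fin κ → Fin 2) :
    (onQubit c A * M) x y = ∑ b, A (x c) b * M (Function.update x c b) y := by
  simp only [Matrix.mul_apply, onQubit_apply, Finset.sum_mul, ite_mul, zero_mul]
  rw [Finset.sum_comm]
  simp

lemma onQubit_add (c : Fin κ) (A B : Matrix (Fin 2) (Fin 2) ℂ) :
    onQubit c A + onQubit c B = onQubit c (A + B) := by
  ext x y
  simp only [onQubit, Matrix.add_apply, Matrix.of_apply]
  split_ifs <;> simp

lemma onQubit_smul (c : Fin κ) (r : ℂ) (A : Matrix (Fin 2) (Fin 2) ℂ) :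
    r • onQubit c A = onQubit c (r • A) := by
  ext x y
  simp only [onQubit, Matrix.smul_apply, Matrix.of_apply]
  split_ifs <;> simp

lemma onQubit_one (c : Fin κ) : onQubit c (1 : Matrix (Fin 2) (Fin 2) ℂ) = 1 := by
  ext x y
  rw [onQubit_apply, Matrix.one_apply]
  simp only [Matrix.one_apply]
  rw [Finset.sum_eq_single (x c)]
  · simp [eq_comm]
  · intro b _ hb
    simp [hb.symm]
  · simp

lemma onQubit_conjTranspose (c : Fin κ) (A : Matrix (Fin 2) (Fin 2) ℂ) :
    (onQubit c A)ᴴ = onQubit c Aᴴ := by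
  ext x y
  simp only [onQubit, Matrix.conjTranspose_apply, Matrix.of_apply]
  have : (∀ d, d ≠ c → y d = x d) ↔ ∀ d, d ≠ c → x d = y d :=
    forall₂_congr fun d _ => eq_comm
  simp only [this]
  split_ifs <;> simp

lemma onQubit_mul_onQubit (c : Fin κ) (A B : Matrix (Fin 2) (Fin 2) ℂ) :
    onQubit c A * onQubit c B = onQubit c (A * B) := by
  ext x y
  rw [onQubit_mul_apply]
  simp only [onQubit_apply, Function.update_self, Function.update_idem, Matrix.mul_apply,
    Finset.mul_sum, mul_ite, mul_zero]
  rw [Finset.sum_comm]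
  refine Finset.sum_congr rfl fun b _ => ?_
  split_ifs <;> simp

lemma onQubit_commute {c d : Fin κ} (h : c ≠ d) (A B : Matrix (Fin 2) (Fin 2) ℂ) :
    onQubit c A * onQubit d B = onQubit d B * onQubit c A := by
  ext x y
  simp only [onQubit_mul_apply, onQubit_apply, Function.update_of_ne h,
    Function.update_of_ne h.symm, Finset.mul_sum, mul_ite, mul_zero]
  rw [Finset.sum_comm]
  refine Finset.sum_congr rfl fun b _ => Finset.sum_congr rfl fun b' _ => ?_
  rw [Function.update_comm h, mul_comm]

/-- The lowering operator `σ⁻ = |0⟩⟨1| = (σˣ + i σʸ) / 2` on qubit `c`. -/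
def lower (c : Fin κ) : Op κ := onQubit c !![0, 1; 0, 0]

lemma lower_conjTranspose (c : Fin κ) : (lower c)ᴴ = onQubit c !![0, 0; 1, 0] := by
  rw [lower, onQubit_conjTranspose]
  congr 1
  ext i j
  fin_cases i <;> fin_cases j <;> simp

lemma lower_apply (c : Fin κ) (x y : Fin κ → Fin 2) :
    lower c x y = if x c = 0 ∧ y = Function.update x c 1 then 1 else 0 := by
  rw [lower, onQubit_apply, Fin.sum_univ_two]
  have : x c = 0 ∨ x c = 1 := by omega
  rcases this with h | h <;> simp [h]

lemma ann_eq (c : Fin κ) : ann c = jwString c * lower c := by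
  rw [ann, pauliX, pauliY, lower, onQubit_smul, onQubit_add, onQubit_smul]
  congr 2
  ext i j
  fin_cases i <;> fin_cases j <;> simp
  norm_num

lemma lower_mul_self (c : Fin κ) : lower c * lower c = 0 := by
  rw [lower, onQubit_mul_onQubit]
  have : (!![0, 1; 0, 0] * !![0, 1; 0, 0] : Matrix (Fin 2) (Fin 2) ℂ) = (0 : ℂ) • 1 := by
    ext i j
    fin_cases i <;> fin_cases j <;> simp
  rw [this, ← onQubit_smul, zero_smul]

lemma lower_anticomm_self (c : Fin κ) :
    lower c * (lower c)ᴴ + (lower c)ᴴ * lower c = 1 := by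
  rw [lower_conjTranspose, lower, onQubit_mul_onQubit, onQubit_mul_onQubit, onQubit_add,
    ← onQubit_one c]
  congr 1
  ext i j
  fin_cases i <;> fin_cases j <;> simp

lemma lower_conjTranspose_mul_self (c : Fin κ) : (lower c)ᴴ * lower c = occupation c := by
  rw [occupation, pauliZ, lower_conjTranspose, lower, onQubit_mul_onQubit, ← onQubit_one c,
    sub_eq_add_neg, ← neg_one_smul ℂ (onQubit c _), onQubit_smul, onQubit_add, onQubit_smul]
  congr 1
  ext i j
  fin_cases i <;> fin_cases j <;> simp
  norm_num

lemma lower_mul_lower {c d : Fin κ} (h : c ≠ d) : lower c * lower d = lower d * lower c :=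
  onQubit_commute h _ _

lemma lower_mul_raise {c d : Fin κ} (h : c ≠ d) :
    lower c * (lower d)ᴴ = (lower d)ᴴ * lower c := by
  rw [lower_conjTranspose]
  exact onQubit_commute h _ _

/-- On distinct qubits, the `XY` interaction is spin hopping. -/
lemma half_xyPair {c d : Fin κ} (h : c ≠ d) :
    (1 / 2 : ℂ) • xyPair c d = (lower c)ᴴ * lower d + (lower d)ᴴ * lower c := by
  have hX : ∀ c : Fin κ, pauliX c = lower c + (lower c)ᴴ := by
    intro c
    rw [lower_conjTranspose, lower, pauliX, onQubit_add]
    congr 1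
    ext i j
    fin_cases i <;> fin_cases j <;> simp
  have hY : ∀ c : Fin κ, pauliY c = (-I) • (lower c - (lower c)ᴴ) := by
    intro c
    rw [lower_conjTranspose, lower, pauliY, sub_eq_add_neg, ← neg_one_smul ℂ (onQubit c _),
      onQubit_smul, onQubit_add, onQubit_smul]
    congr 1
    ext i j
    fin_cases i <;> fin_cases j <;> simp
  rw [xyPair, hX, hX, hY, hY, ← lower_mul_raise h]
  rw [smul_mul_smul_comm, neg_mul_neg, I_mul_I, neg_one_smul, ← sub_eq_add_neg]
  have : (lower c + (lower c)ᴴ) * (lower d + (lower d)ᴴ) -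
      (lower c - (lower c)ᴴ) * (lower d - (lower d)ᴴ) =
      (2 : ℂ) • ((lower c)ᴴ * lower d + lower c * (lower d)ᴴ) := by
    rw [two_smul]
    noncomm_ring
  rw [this, smul_smul]
  norm_num

/-! ### Jordan–Wigner strings and the canonical anticommutation relations -/

lemma card_filter_update (p : Fin κ → Prop) [DecidablePred p] {c : Fin κ} {x : Fin κ → Fin 2}
    (hx : x c = 0) :
    (Finset.univ.filter fun d => p d ∧ Function.update x c 1 d = 1).card =
      (Finset.univ.filter fun d => p d ∧ x d = 1).card + if p c then 1 else 0 := by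
  split_ifs with hp
  · rw [← Finset.card_insert_of_notMem (a := c) (by simp [hx])]
    congr 1
    ext d
    by_cases hd : d = c
    · subst hd
      simp [hp]
    · simp [hd]
  · rw [add_zero]
    congr 1
    ext d
    by_cases hd : d = c
    · subst hd
      simp [hp]
    · simp [hd]

lemma hammingWeight_update {c : Fin κ} {x : Fin κ → Fin 2} (hx : x c = 0) :
    hammingWeight (Function.update x c 1) = hammingWeight x + 1 := by
  simpa [hammingWeight] using card_filter_update (fun _ => True) hx

/-- Moving a diagonal operator past `σ⁻` evaluates it before the qubit is emptied. -/
lemma lower_mul_diagonal (c : Fin κ) (f g : (Fin κ → Fin 2) → ℂ)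
    (h : ∀ x, x c = 0 → f (Function.update x c 1) = g x) :
    lower c * diagonal f = diagonal g * lower c := by
  ext x y
  rw [Matrix.mul_diagonal, Matrix.diagonal_mul, lower_apply]
  split_ifs with hxy
  · rw [hxy.2, h x hxy.1, one_mul, mul_one]
  · simp

/-- The sign picked up when the Jordan–Wigner string of site `d` is moved past the lowering
operator of site `c`. -/
def jwSign (c d : Fin κ) : ℂ := if c < d then -1 else 1

lemma jwSign_mul_jwSign {c d : Fin κ} (h : c ≠ d) : jwSign c d * jwSign d c = -1 := by
  rcases lt_or_gt_of_ne h with h | h <;> simp [jwSign, h, not_lt_of_gt h]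

lemma jwSign_add_jwSign {c d : Fin κ} (h : c ≠ d) : jwSign c d + jwSign d c = 0 := by
  rcases lt_or_gt_of_ne h with h | h <;> simp [jwSign, h, not_lt_of_gt h]

lemma lower_mul_jwString (c d : Fin κ) :
    lower c * jwString d = jwSign c d • (jwString d * lower c) := by
  rw [jwString, lower_mul_diagonal c _
    (jwSign c d • fun x => (-1 : ℂ) ^ (Finset.univ.filter fun e => e < d ∧ x e = 1).card),
    diagonal_smul, smul_mul_assoc]
  intro x hx
  rw [card_filter_update (fun e => e < d) hx, Pi.smul_apply, smul_eq_mul, jwSign]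
  split_ifs <;> simp [pow_succ]

lemma jwString_conjTranspose (c : Fin κ) : (jwString c)ᴴ = jwString c := by
  rw [jwString, diagonal_conjTranspose]
  congr 1
  ext x
  simp

lemma jwString_mul_self (c : Fin κ) : jwString c * jwString c = 1 := by
  rw [jwString, diagonal_mul_diagonal, ← diagonal_one]
  congr 1
  ext x
  rw [← mul_pow]
  simp

lemma jwString_comm (c d : Fin κ) : jwString c * jwString d = jwString d * jwString c := by
  simp only [jwString, diagonal_mul_diagonal, mul_comm]

lemma jwString_mul_raise (c d : Fin κ) :
    jwString d * (lower c)ᴴ = jwSign c d • ((lower c)ᴴ * jwString d) := by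
  have h := congrArg conjTranspose (lower_mul_jwString c d)
  rw [conjTranspose_mul, conjTranspose_smul, conjTranspose_mul, jwString_conjTranspose] at h
  rw [h]
  congr 1
  rw [jwSign]
  split_ifs <;> simp

lemma ann_conjTranspose (c : Fin κ) : (ann c)ᴴ = (lower c)ᴴ * jwString c := by
  rw [ann_eq, conjTranspose_mul, jwString_conjTranspose]

lemma ann_conjTranspose_mul_self (c : Fin κ) : (ann c)ᴴ * ann c = occupation c := by
  rw [ann_conjTranspose, ann_eq, mul_assoc, ← mul_assoc (jwString c), jwString_mul_self, one_mul,
    lower_conjTranspose_mul_self]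

lemma lower_comm_jwString_self (c : Fin κ) : lower c * jwString c = jwString c * lower c := by
  simp [lower_mul_jwString, jwSign]

/-- On a single site the strings square to one. On distinct sites the lowering operators commute,
and exactly one of the two strings changes sign when it is moved past the lowering operator of the
other site. -/
theorem isCAR_ann : IsCAR (ann : Fin κ → Op κ) := by
  constructor
  · intro c d
    split_ifs with h
    · subst h
      have h2 : (lower c)ᴴ * jwString c = jwString c * (lower c)ᴴ := by
        simp [jwString_mul_raise, jwSign]
      rw [ann_conjTranspose_mul_self, ann_conjTranspose, ann_eq, ← lower_comm_jwString_self,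
        h2, mul_assoc, ← mul_assoc (jwString c), jwString_mul_self, one_mul,
        ← lower_conjTranspose_mul_self, lower_anticomm_self]
    · rw [ann_conjTranspose, ann_eq]
      have h1 : jwString c * lower c * ((lower d)ᴴ * jwString d) =
          (jwSign d c * jwSign c d) • ((lower d)ᴴ * (jwString c * jwString d) * lower c) := by
        calc jwString c * lower c * ((lower d)ᴴ * jwString d)
            = jwString c * (lower c * (lower d)ᴴ) * jwString d := by simp only [mul_assoc]
          _ = (jwString c * (lower d)ᴴ) * (lower c * jwString d) := by
              rw [lower_mul_raise h]
              simp only [mul_assoc]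
          _ = _ := by
              rw [jwString_mul_raise, lower_mul_jwString, smul_mul_smul_comm]
              simp only [mul_assoc]
      rw [h1, jwSign_mul_jwSign (Ne.symm h), jwString_comm c d]
      simp only [mul_assoc, neg_smul, one_smul, neg_add_cancel]
  · intro c d
    by_cases h : c = d
    · subst h
      rw [ann_eq, ← lower_comm_jwString_self, mul_assoc, ← mul_assoc (jwString c),
        ← lower_comm_jwString_self, mul_assoc, ← mul_assoc, ← mul_assoc, lower_mul_self]
      simp
    · rw [ann_eq, ann_eq]
      have h1 : ∀ c d : Fin κ, jwString c * lower c * (jwString d * lower d) =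
          jwSign c d • (jwString c * jwString d * (lower c * lower d)) := by
        intro c d
        rw [mul_assoc, ← mul_assoc (lower c), lower_mul_jwString, smul_mul_assoc, mul_smul_comm]
        simp only [mul_assoc]
      rw [h1, h1, jwString_comm d c, lower_mul_lower (Ne.symm h), ← add_smul,
        jwSign_add_jwSign h, zero_smul]

/-! ### Conservation of the Hamming weight -/

/-- A function of the Hamming weight, as a diagonal operator. -/
def weightFn (f : ℕ → ℂ) : Op κ := diagonal fun x => f (hammingWeight x)

lemma parity_eq : parity κ = weightFn fun n => (-1) ^ n := rfl

lemma lower_mul_weightFn (c : Fin κ) (f : ℕ → ℂ) :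
    lower c * weightFn f = weightFn (fun n => f (n + 1)) * lower c :=
  lower_mul_diagonal c _ _ fun x hx => by rw [hammingWeight_update hx]

lemma raise_mul_weightFn (c : Fin κ) (f : ℕ → ℂ) :
    (lower c)ᴴ * weightFn (fun n => f (n + 1)) = weightFn f * (lower c)ᴴ := by
  have h := congrArg conjTranspose (lower_mul_weightFn c fun n => star (f n))
  simp only [conjTranspose_mul, weightFn, diagonal_conjTranspose] at h
  simpa [weightFn, Pi.star_def] using h.symm

lemma ann_mul_weightFn (c : Fin κ) (f : ℕ → ℂ) :
    ann c * weightFn f = weightFn (fun n => f (n + 1)) * ann c := by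
  rw [ann_eq, mul_assoc, lower_mul_weightFn, ← mul_assoc, ← mul_assoc]
  congr 1
  simp only [jwString, weightFn, diagonal_mul_diagonal, mul_comm]

lemma annDag_mul_weightFn (c : Fin κ) (f : ℕ → ℂ) :
    (ann c)ᴴ * weightFn (fun n => f (n + 1)) = weightFn f * (ann c)ᴴ := by
  rw [ann_conjTranspose, ← mul_assoc, ← raise_mul_weightFn, mul_assoc, mul_assoc]
  congr 1
  simp only [jwString, weightFn, diagonal_mul_diagonal, mul_comm]

lemma commute_weightFn_annDag_mul_ann (c d : Fin κ) (f : ℕ → ℂ) :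
    Commute (weightFn f) ((ann c)ᴴ * ann d) := by
  rw [Commute, SemiconjBy, ← mul_assoc, ← annDag_mul_weightFn, mul_assoc, mul_assoc,
    ann_mul_weightFn]

lemma commute_weightFn_hop (c d : Fin κ) (f : ℕ → ℂ) : Commute (weightFn f) (hop c d) :=
  (commute_weightFn_annDag_mul_ann c d f).add_right (commute_weightFn_annDag_mul_ann d c f)

lemma commute_weightFn_fermionRing (f : ℕ → ℂ) : Commute (weightFn f) (fermionRing κ) :=
  Commute.sum_right _ _ _ fun c _ => commute_weightFn_hop c _ f

/-! ### The `XY` ring as a fermionic Hamiltonian -/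

lemma next_ne (hκ : 2 ≤ κ) (c : Fin κ) : c ≠ next c := by
  intro h
  have h' : (c : ℕ) = (c + 1) % κ := congrArg Fin.val h
  rcases Nat.lt_or_ge (c + 1) κ with h1 | h1
  · rw [Nat.mod_eq_of_lt h1] at h'
    omega
  · have : (c : ℕ) + 1 = κ := by omega
    rw [this, Nat.mod_self] at h'
    omega

/-- The string of the site after `c` extends the string of `c` by `σᶻ_c`, which acts trivially
after `c` has been emptied. -/
lemma jwString_succ_mul_lower {c d : Fin κ} (h : (d : ℕ) = c + 1) :
    jwString d * lower c = jwString c * lower c := by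
  ext x y
  rw [jwString, jwString, diagonal_mul, diagonal_mul, lower_apply]
  split_ifs with hx
  · congr 2
    congr 1
    ext e
    simp only [Finset.mem_filter, Finset.mem_univ, true_and]
    constructor
    · rintro ⟨h1, h2⟩
      have : e ≠ c := by
        rintro rfl
        rw [hx.1] at h2
        exact absurd h2 (by decide)
      have : (e : ℕ) ≠ c := fun h => this (Fin.ext h)
      exact ⟨by rw [Fin.lt_def] at h1 ⊢; omega, h2⟩
    · rintro ⟨h1, h2⟩
      exact ⟨by rw [Fin.lt_def] at h1 ⊢; omega, h2⟩
  · simp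

/-- The string of the last site is the full parity once that site has been emptied. -/
lemma jwString_last_mul_lower {c : Fin κ} (h : (c : ℕ) + 1 = κ) :
    jwString c * lower c = parity κ * lower c := by
  ext x y
  rw [jwString, parity, diagonal_mul, diagonal_mul, lower_apply]
  split_ifs with hx
  · rw [hammingWeight]
    congr 2
    congr 1
    ext e
    simp only [Finset.mem_filter, Finset.mem_univ, true_and, and_iff_right_iff_imp]
    intro h2
    have : e ≠ c := by
      rintro rfl
      rw [hx.1] at h2
      exact absurd h2 (by decide)
    have : (e : ℕ) ≠ c := fun h => this (Fin.ext h)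
    rw [Fin.lt_def]
    omega
  · simp

lemma jwString_zero {c : Fin κ} (h : (c : ℕ) = 0) : jwString c = 1 := by
  rw [jwString, ← diagonal_one]
  congr 1
  ext x
  rw [Finset.card_eq_zero.2, pow_zero]
  ext e
  simp only [Finset.mem_filter, Finset.mem_univ, true_and, Finset.notMem_empty, iff_false,
    Fin.lt_def]
  omega

lemma annDag_mul_ann_succ {c d : Fin κ} (h : (d : ℕ) = c + 1) :
    (ann d)ᴴ * ann c = (lower d)ᴴ * lower c := by
  rw [ann_conjTranspose, ann_eq, ← jwString_succ_mul_lower h, mul_assoc,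
    ← mul_assoc (jwString d), jwString_mul_self, one_mul]

lemma hop_eq_of_succ {c d : Fin κ} (h : (d : ℕ) = c + 1) :
    hop c d = (1 / 2 : ℂ) • xyPair c d := by
  have hne : c ≠ d := by
    rintro rfl
    omega
  have h1 := congrArg conjTranspose (annDag_mul_ann_succ h)
  simp only [conjTranspose_mul, conjTranspose_conjTranspose] at h1
  rw [half_xyPair hne, hop, h1, annDag_mul_ann_succ h]

lemma parity_conjTranspose : (parity κ)ᴴ = parity κ := by
  rw [parity, diagonal_conjTranspose]
  congr 1
  ext x
  simp

lemma parity_mul_self : parity κ * parity κ = 1 := by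
  rw [parity, diagonal_mul_diagonal, ← diagonal_one]
  congr 1
  ext x
  rw [← mul_pow]
  simp

lemma lower_mul_parity (c : Fin κ) : lower c * parity κ = -(parity κ * lower c) := by
  rw [parity_eq, lower_mul_weightFn, ← neg_mul, weightFn, weightFn, diagonal_neg]
  congr 2
  ext x
  simp [pow_succ]

/-- For the hopping between the two ends of the chain, the string is the parity operator up to sign
and cancels against `G`. -/
lemma boundary_eq {first last : Fin κ} (h0 : (first : ℕ) = 0) (hl : (last : ℕ) + 1 = κ) :
    (ann last)ᴴ * ann first * parity κ = -((lower last)ᴴ * lower first) := by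
  have h1 : (ann last)ᴴ = (lower last)ᴴ * parity κ := by
    rw [ann_eq, jwString_last_mul_lower hl, conjTranspose_mul, parity_conjTranspose]
  rw [h1, ann_eq, jwString_zero h0, one_mul, mul_assoc, mul_assoc, lower_mul_parity, mul_neg,
    mul_neg, ← mul_assoc (parity κ), parity_mul_self, one_mul]

theorem xyRing_eq (hκ : 2 ≤ κ) {first last : Fin κ} (h0 : (first : ℕ) = 0)
    (hl : (last : ℕ) + 1 = κ) :
    xyRing κ = (∑ c ∈ Finset.univ.erase last, hop c (next c)) -
      ((ann last)ᴴ * ann first * parity κ + ((ann last)ᴴ * ann first * parity κ)ᴴ) := by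
  have hnext : next last = first := by
    apply Fin.ext
    change ((last : ℕ) + 1) % κ = first
    rw [hl, Nat.mod_self, h0]
  have hne := next_ne hκ last
  rw [xyRing, Finset.smul_sum, ← Finset.sum_erase_add _ _ (Finset.mem_univ last), hnext,
    sub_eq_add_neg]
  congr 1
  · refine Finset.sum_congr rfl fun c hc => ?_
    rw [hop_eq_of_succ]
    have hc' : c ≠ last := (Finset.mem_erase.1 hc).1
    have : (c : ℕ) ≠ last := fun h => hc' (Fin.ext h)
    change ((c : ℕ) + 1) % κ = c + 1
    exact Nat.mod_eq_of_lt (by omega)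
  · rw [hnext] at hne
    rw [half_xyPair hne, boundary_eq h0 hl, conjTranspose_neg, conjTranspose_mul,
      conjTranspose_conjTranspose]
    abel

/-- In the odd sector, where `1 - G` is invertible, the sign of the boundary term is that of the
periodic ring. -/
theorem xyRing_mul_eq_fermionRing_mul (hκ : 2 ≤ κ) :
    xyRing κ * (1 - parity κ) = fermionRing κ * (1 - parity κ) := by
  have hQ : parity κ * (1 - parity κ) = -(1 - parity κ) := by
    rw [mul_sub, parity_mul_self]
    simp
  let last : Fin κ := ⟨κ - 1, by omega⟩
  let first : Fin κ := ⟨0, by omega⟩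
  have hnext : next last = first := by
    apply Fin.ext
    change (κ - 1 + 1) % κ = 0
    rw [Nat.sub_add_cancel (by omega), Nat.mod_self]
  have hc := commute_weightFn_annDag_mul_ann first last fun n => (-1) ^ n
  rw [← parity_eq, Commute, SemiconjBy] at hc
  rw [xyRing_eq hκ (first := first) (last := last) rfl (Nat.sub_add_cancel (by omega)),
    fermionRing, ← Finset.sum_erase_add _ _ (Finset.mem_univ last), hnext, sub_mul,
    sub_eq_add_neg, add_mul (∑ c ∈ _, _)]
  congr 1
  rw [conjTranspose_mul, conjTranspose_mul, conjTranspose_conjTranspose, parity_conjTranspose,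
    hc, hop, ← add_mul _ _ (parity κ), mul_assoc _ (parity κ), hQ, mul_neg, neg_neg]

/-- The operator `1 - G` is twice the projection onto the odd sector. -/
lemma mulVec_congr_of_isOdd {A B : Op κ} (h : A * (1 - parity κ) = B * (1 - parity κ))
    {ψ : State κ} (hψ : IsOdd ψ) : A *ᵥ ψ = B *ᵥ ψ := by
  have h1 : (1 - parity κ) *ᵥ ψ = (2 : ℂ) • ψ := by
    rw [sub_mulVec, one_mulVec, hψ, sub_neg_eq_add, two_smul]
  have h2 := congrArg (· *ᵥ ψ) h
  simp only [← mulVec_mulVec, h1, mulVec_smul] at h2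
  exact smul_right_injective _ two_ne_zero h2

lemma xyRing_mulVec_of_isOdd (hκ : 2 ≤ κ) {ψ : State κ} (h : IsOdd ψ) :
    xyRing κ *ᵥ ψ = fermionRing κ *ᵥ ψ :=
  mulVec_congr_of_isOdd (xyRing_mul_eq_fermionRing_mul hκ) h

/-! ### Fock states and the fermionic Fourier transform of a general number of modes -/

/-- The state `b_{c₁}† ⋯ b_{c_N}† |0…0⟩` for a list `c₁, …, c_N` of modes. -/
def fockState (b : Fin κ → Op κ) (l : List (Fin κ)) : State κ :=
  (l.map fun c => (b c)ᴴ).prod *ᵥ vacuum κ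

/-- The sites of a bit string that hold a one, in increasing order. -/
def ones (x : Fin κ → Fin 2) : List (Fin κ) := (List.finRange κ).filter fun c => x c = 1

lemma fockState_nil (b : Fin κ → Op κ) : fockState b [] = vacuum κ := by
  simp [fockState]

lemma fockState_cons (b : Fin κ → Op κ) (d : Fin κ) (l : List (Fin κ)) :
    fockState b (d :: l) = (b d)ᴴ *ᵥ fockState b l := by
  simp [fockState, mulVec_mulVec]

/-- The expansion of `b_c b_{c₁}† ⋯ b_{c_N}† |0…0⟩` in Fock states that results from moving `b_c`
to the right with the anticommutation relations: the coefficients and the lists of remaining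
modes. It does not depend on the family `b`. -/
def contract (c : Fin κ) : List (Fin κ) → List (ℂ × List (Fin κ))
  | [] => []
  | d :: l => (if c = d then [(1, l)] else []) ++
      (contract c l).map fun p => (-p.1, d :: p.2)

lemma sublist_of_mem_contract (c : Fin κ) (l : List (Fin κ)) :
    ∀ p ∈ contract c l, p.2.Sublist l := by
  induction l with
  | nil => simp [contract]
  | cons d l ih =>
    intro p hp
    rw [contract, List.mem_append, List.mem_map] at hp
    rcases hp with hp | ⟨q, hq, rfl⟩
    · split_ifs at hp
      · rw [List.mem_singleton.1 hp]
        exact List.sublist_cons_self d l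
      · simp at hp
    · exact (ih q hq).cons_cons d

lemma mulVec_list_sum {ι : Type*} (M : Op κ) (L : List ι) (f : ι → State κ) :
    M *ᵥ (L.map f).sum = (L.map fun p => M *ᵥ f p).sum := by
  induction L with
  | nil => simp
  | cons p L ih => simp [mulVec_add, ih]

lemma mulVec_fockState {b : Fin κ → Op κ} (hb : IsCAR b) (h0 : ∀ c, b c *ᵥ vacuum κ = 0)
    (c : Fin κ) (l : List (Fin κ)) :
    b c *ᵥ fockState b l = ((contract c l).map fun p => p.1 • fockState b p.2).sum := by
  induction l with
  | nil => simp [contract, fockState_nil, h0]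
  | cons d l ih =>
    have h1 : b c * (b d)ᴴ = (if c = d then 1 else 0) - (b d)ᴴ * b c :=
      eq_sub_of_add_eq (hb.1 c d)
    rw [fockState_cons, mulVec_mulVec, h1, sub_mulVec, ← mulVec_mulVec, ih, mulVec_list_sum,
      contract, List.map_append, List.sum_append, sub_eq_add_neg]
    congr 1
    · split_ifs <;> simp
    · rw [List.map_map]
      induction contract c l with
      | nil => simp
      | cons p L ihL =>
        rw [List.map_cons, List.sum_cons, neg_add, ihL]
        simp [fockState_cons, mulVec_smul]

lemma star_mulVec_dotProduct (A : Op κ) (v w : State κ) :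
    star (Aᴴ *ᵥ v) ⬝ᵥ w = star v ⬝ᵥ (A *ᵥ w) := by
  rw [star_mulVec, conjTranspose_conjTranspose, dotProduct_mulVec]

lemma dotProduct_list_sum {ι : Type*} (v : State κ) (L : List ι) (f : ι → State κ) :
    v ⬝ᵥ (L.map f).sum = (L.map fun p => v ⬝ᵥ f p).sum := by
  induction L with
  | nil => simp
  | cons p L ih => simp [dotProduct_add, ih]

/-- Inner products of Fock states are the same for all families of fermionic operators that
annihilate the vacuum. -/
lemma gram_eq {b b' : Fin κ → Op κ} (hb : IsCAR b) (h0 : ∀ c, b c *ᵥ vacuum κ = 0)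
    (hb' : IsCAR b') (h0' : ∀ c, b' c *ᵥ vacuum κ = 0) (l l' : List (Fin κ)) :
    star (fockState b l) ⬝ᵥ fockState b l' = star (fockState b' l) ⬝ᵥ fockState b' l' := by
  induction l generalizing l' with
  | nil =>
    have key : ∀ b : Fin κ → Op κ, (∀ c, b c *ᵥ vacuum κ = 0) → ∀ d l,
        star (fockState b []) ⬝ᵥ fockState b (d :: l) = 0 := by
      intro b h0 d l
      rw [fockState_nil, fockState_cons, ← star_mulVec_dotProduct, conjTranspose_conjTranspose,
        h0]
      simp
    cases l' with
    | nil => rw [fockState_nil, fockState_nil]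
    | cons d l' => rw [key b h0, key b' h0']
  | cons d l ih =>
    rw [fockState_cons, fockState_cons, star_mulVec_dotProduct, star_mulVec_dotProduct,
      mulVec_fockState hb h0, mulVec_fockState hb' h0', dotProduct_list_sum, dotProduct_list_sum]
    simp only [dotProduct_smul, ih]

lemma ann_mulVec_vacuum (c : Fin κ) : ann c *ᵥ vacuum κ = 0 := by
  rw [ann_eq, ← mulVec_mulVec]
  have : lower c *ᵥ vacuum κ = 0 := by
    ext x
    rw [mulVec, dotProduct]
    refine Finset.sum_eq_zero fun y _ => ?_
    rw [lower_apply, vacuum]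
    split_ifs with h1 h2 h2
    · exfalso
      have := congrFun (h1.2.symm.trans h2) c
      simp at this
    all_goals simp
  rw [this, mulVec_zero]

/-- Creating a particle before all the others involves no sign. -/
lemma annDag_mulVec_single {c : Fin κ} {x : Fin κ → Fin 2} (h : ∀ d, d ≤ c → x d = 0) :
    (ann c)ᴴ *ᵥ Pi.single x 1 = Pi.single (Function.update x c 1) 1 := by
  ext y
  rw [mulVec_single_one, col_apply, conjTranspose_apply, ann_eq, jwString, diagonal_mul,
    lower_apply, Finset.card_eq_zero.2, pow_zero, one_mul, Pi.single_apply]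
  · simp [h c le_rfl, apply_ite]
  · ext d
    simp only [Finset.mem_filter, Finset.mem_univ, true_and, Finset.notMem_empty, iff_false]
    rintro ⟨h1, h2⟩
    rw [h d h1.le] at h2
    exact absurd h2 (by decide)

lemma fockState_ann {l : List (Fin κ)} (hl : l.Pairwise (· < ·)) :
    fockState ann l = Pi.single (fun c => if c ∈ l then 1 else 0) 1 := by
  induction l with
  | nil =>
    ext x
    rw [fockState_nil, vacuum, Pi.single_apply]
    rfl
  | cons d l ih =>
    rw [List.pairwise_cons] at hl
    rw [fockState_cons, ih hl.2, annDag_mulVec_single]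
    · congr 1
      ext c
      by_cases hc : c = d
      · subst hc
        simp
      · simp [hc]
    · intro e he
      rw [if_neg]
      exact fun h => absurd (hl.1 e h) (not_lt_of_ge he)

lemma pairwise_ones (x : Fin κ → Fin 2) : (ones x).Pairwise (· < ·) :=
  (List.pairwise_lt_finRange κ).filter _

lemma fockState_ann_ones (x : Fin κ → Fin 2) : fockState ann (ones x) = Pi.single x 1 := by
  rw [fockState_ann (pairwise_ones x)]
  congr 1
  ext c
  have : x c = 0 ∨ x c = 1 := by omega
  rcases this with h | h <;> simp [ones, h]

lemma ones_indicator {l : List (Fin κ)} (hl : l.Pairwise (· < ·)) :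
    ones (fun c => if c ∈ l then 1 else 0) = l := by
  refine List.SortedLT.eq_of_mem_iff (pairwise_ones _).sortedLT hl.sortedLT fun c => ?_
  simp [ones]

lemma FFFT_mulVec_single (x : Fin κ → Fin 2) :
    FFFT κ *ᵥ Pi.single x 1 = fockState image (ones x) := by
  ext y
  rw [mulVec_single_one, col_apply]
  rfl

lemma FFFT_mulVec_fockState {l : List (Fin κ)} (hl : l.Pairwise (· < ·)) :
    FFFT κ *ᵥ fockState ann l = fockState image l := by
  rw [fockState_ann hl, FFFT_mulVec_single, ones_indicator hl]

lemma op_ext {A B : Op κ} (h : ∀ x : Fin κ → Fin 2, A *ᵥ Pi.single x 1 = B *ᵥ Pi.single x 1) :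
    A = B := by
  ext y x
  have := congrFun (h x) y
  rwa [mulVec_single_one, mulVec_single_one] at this

lemma FFFT_mulVec_vacuum : FFFT κ *ᵥ vacuum κ = vacuum κ := by
  have := FFFT_mulVec_fockState (κ := κ) List.Pairwise.nil
  rwa [fockState_nil, fockState_nil] at this

/-! ### Linear transformations of the modes -/

/-- The operators `∑_c V_{kc} a_c`. -/
def modes (V : Matrix (Fin κ) (Fin κ) ℂ) (a : Fin κ → Op κ) (k : Fin κ) : Op κ :=
  ∑ c, V k c • a c

lemma modes_modes (V W : Matrix (Fin κ) (Fin κ) ℂ) (a : Fin κ → Op κ) :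
    modes V (modes W a) = modes (V * W) a := by
  ext1 k
  simp only [modes, Finset.smul_sum, smul_smul, Matrix.mul_apply, Finset.sum_smul]
  exact Finset.sum_comm

lemma modes_one (a : Fin κ → Op κ) : modes 1 a = a := by
  ext1 k
  simp [modes, Matrix.one_apply]

lemma isCAR_modes {V : Matrix (Fin κ) (Fin κ) ℂ} (hV : V * Vᴴ = 1) {a : Fin κ → Op κ}
    (ha : IsCAR a) : IsCAR (modes V a) := by
  constructor
  · intro k l
    have h1 : modes V a k * (modes V a l)ᴴ + (modes V a l)ᴴ * modes V a k =
        ∑ c, ∑ d, (V k c * star (V l d)) • (a c * (a d)ᴴ + (a d)ᴴ * a c) := by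
      simp only [modes, conjTranspose_sum, conjTranspose_smul, Finset.sum_mul_sum,
        smul_mul_smul_comm, smul_add, Finset.sum_add_distrib]
      congr 1
      rw [Finset.sum_comm]
      simp only [mul_comm]
    have h2 := congrFun (congrFun hV k) l
    rw [Matrix.mul_apply] at h2
    simp only [h1, ha.1, smul_ite, smul_zero, Finset.sum_ite_eq, Finset.mem_univ, if_true]
    rw [← Finset.sum_smul]
    simp only [conjTranspose_apply] at h2
    rw [h2, Matrix.one_apply]
    split_ifs <;> simp
  · intro k l
    have h1 : modes V a k * modes V a l + modes V a l * modes V a k =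
        ∑ c, ∑ d, (V k c * V l d) • (a c * a d + a d * a c) := by
      simp only [modes, Finset.sum_mul_sum, smul_mul_smul_comm, smul_add, Finset.sum_add_distrib]
      congr 1
      rw [Finset.sum_comm]
      simp only [mul_comm]
    simp [h1, ha.2]

/-- The matrix of the discrete Fourier transform, with entries `κ^(-1/2) e^{-2πi ck/κ}`. -/
def dft (κ : ℕ) : Matrix (Fin κ) (Fin κ) ℂ :=
  Matrix.of fun k c => ((1 / Real.sqrt κ : ℝ) : ℂ) *
    Complex.exp (-(2 * Real.pi * I * (c : ℕ) * (k : ℕ) / κ))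

lemma mode_eq_modes : (mode : Fin κ → Op κ) = modes (dft κ) ann := by
  ext1 k
  simp only [mode, modes, dft, Matrix.of_apply, Finset.smul_sum, smul_smul]

lemma star_dft_apply (k c : Fin κ) : star (dft κ k c) =
    ((1 / Real.sqrt κ : ℝ) : ℂ) * Complex.exp (2 * Real.pi * I * (c : ℕ) * (k : ℕ) / κ) := by
  rw [dft, Matrix.of_apply, star_mul', RCLike.star_def, Complex.conj_ofReal,
    ← Complex.exp_conj]
  congr 2
  simp only [map_neg, map_div₀, map_mul, map_ofNat, conj_ofReal, conj_I, map_natCast]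
  ring

lemma image_eq_modes : (image : Fin κ → Op κ) = modes (dft κ)ᴴ ann := by
  ext1 c
  simp only [image, modes, conjTranspose_apply, star_dft_apply, Finset.smul_sum, smul_smul]

lemma dft_mul_conjTranspose : dft κ * (dft κ)ᴴ = 1 := by
  ext k l
  have hκ : (κ : ℂ) ≠ 0 := by
    have := k.pos
    exact_mod_cast this.ne'
  have hs : ((1 / Real.sqrt κ : ℝ) : ℂ) * ((1 / Real.sqrt κ : ℝ) : ℂ) = 1 / κ := by
    rw [← Complex.ofReal_mul, div_mul_div_comm, Real.mul_self_sqrt (Nat.cast_nonneg κ)]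
    simp
  set z : ℂ := Complex.exp (2 * Real.pi * I * ((l : ℕ) - (k : ℕ)) / κ) with hz
  have h1 : ∀ c : Fin κ, dft κ k c * (dft κ)ᴴ c l = 1 / κ * z ^ (c : ℕ) := by
    intro c
    rw [conjTranspose_apply, star_dft_apply, dft, Matrix.of_apply, mul_mul_mul_comm, hs,
      ← Complex.exp_add, hz, ← Complex.exp_nat_mul]
    congr 2
    field_simp
    ring
  rw [Matrix.mul_apply]
  simp only [h1]
  rw [← Finset.mul_sum, Fin.sum_univ_eq_sum_range (fun i => z ^ i) κ, Matrix.one_apply]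
  split_ifs with h
  · have : z = 1 := by simp [hz, h]
    simp [this, hκ]
  · have hz1 : z ≠ 1 := by
      rw [hz, Ne, Complex.exp_eq_one_iff]
      rintro ⟨n, hn⟩
      have hpi : (2 * Real.pi * I : ℂ) ≠ 0 := by simp [Real.pi_ne_zero]
      have h2 : ((l : ℕ) : ℂ) - (k : ℕ) = n * κ := by
        field_simp at hn
        rw [hn, mul_comm]
      have h3 : ((l : ℕ) : ℤ) - (k : ℕ) = n * κ := by exact_mod_cast h2
      have hn0 : n = 0 := by
        by_contra hn0
        have h4 : (κ : ℤ) ≤ |n * κ| := by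
          rw [abs_mul, Nat.abs_cast]
          have := Int.one_le_abs hn0
          nlinarith [k.pos]
        rw [← h3] at h4
        have := l.2
        have := k.2
        rcases abs_cases (((l : ℕ) : ℤ) - (k : ℕ)) with h | h <;> omega
      rw [hn0, zero_mul, sub_eq_zero] at h3
      exact h (Fin.ext (by exact_mod_cast h3.symm))
    have hzκ : z ^ κ = 1 := by
      rw [hz, ← Complex.exp_nat_mul, Complex.exp_eq_one_iff]
      refine ⟨(l : ℕ) - (k : ℕ), ?_⟩
      push_cast
      field_simp
    rw [geom_sum_eq hz1, hzκ]
    simp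

lemma conjTranspose_mul_dft : (dft κ)ᴴ * dft κ = 1 := mul_eq_one_comm.1 dft_mul_conjTranspose

theorem isCAR_mode : IsCAR (mode : Fin κ → Op κ) := by
  rw [mode_eq_modes]
  exact isCAR_modes dft_mul_conjTranspose isCAR_ann

theorem isCAR_image : IsCAR (image : Fin κ → Op κ) := by
  rw [image_eq_modes]
  exact isCAR_modes (by rw [conjTranspose_conjTranspose, conjTranspose_mul_dft]) isCAR_ann

lemma image_mulVec_vacuum (c : Fin κ) : image c *ᵥ vacuum κ = 0 := by
  rw [image_eq_modes, modes, sum_mulVec]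
  simp [smul_mulVec, ann_mulVec_vacuum]

/-! ### The fermionic Fourier transform diagonalizes the ring -/

/-- The columns of the transform have the Gram matrix of the basis states. -/
lemma FFFT_conjTranspose_mul_self : (FFFT κ)ᴴ * FFFT κ = 1 := by
  ext x y
  have h := gram_eq isCAR_image image_mulVec_vacuum isCAR_ann ann_mulVec_vacuum (ones x) (ones y)
  rw [← FFFT_mulVec_single, ← FFFT_mulVec_single, fockState_ann_ones, fockState_ann_ones,
    mulVec_single_one, mulVec_single_one] at h
  rw [Matrix.mul_apply, Matrix.one_apply]
  refine h.trans ?_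
  simp [Pi.single_apply, eq_comm]

lemma FFFT_mul_conjTranspose_self : FFFT κ * (FFFT κ)ᴴ = 1 :=
  mul_eq_one_comm.1 FFFT_conjTranspose_mul_self

/-- Annihilating a particle before or after the transform leads to the same expansion in Fock
states, by `mulVec_fockState`. -/
lemma FFFT_mul_ann (c : Fin κ) : FFFT κ * ann c = image c * FFFT κ := by
  refine op_ext fun x => ?_
  rw [← mulVec_mulVec, ← mulVec_mulVec, FFFT_mulVec_single, ← fockState_ann_ones x,
    mulVec_fockState isCAR_ann ann_mulVec_vacuum, mulVec_fockState isCAR_image image_mulVec_vacuum,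
    mulVec_list_sum]
  congr 1
  refine List.map_congr_left fun p hp => ?_
  rw [mulVec_smul,
    FFFT_mulVec_fockState ((pairwise_ones x).sublist (sublist_of_mem_contract c _ p hp))]

lemma FFFT_mul_mode (k : Fin κ) : FFFT κ * mode k = ann k * FFFT κ := by
  have h : ∑ c, dft κ k c • image c = ann k := by
    rw [image_eq_modes]
    change modes _ (modes _ _) k = _
    rw [modes_modes, dft_mul_conjTranspose, modes_one]
  rw [mode_eq_modes, modes, Finset.mul_sum, ← h, Finset.sum_mul]
  refine Finset.sum_congr rfl fun c _ => ?_
  rw [mul_smul_comm, FFFT_mul_ann, smul_mul_assoc]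

theorem FFFT_conj_ann (k : Fin κ) : (FFFT κ)ᴴ * ann k * FFFT κ = mode k := by
  rw [mul_assoc, ← FFFT_mul_mode, ← mul_assoc, FFFT_conjTranspose_mul_self, one_mul]

/-- A shift of the site multiplies the plane wave by a phase, around the whole ring. -/
lemma star_dft_next (k c : Fin κ) : star (dft κ k (next c)) =
    Complex.exp (2 * Real.pi * I * (k : ℕ) / κ) * star (dft κ k c) := by
  have hκ : (κ : ℂ) ≠ 0 := by
    have := k.pos
    exact_mod_cast this.ne'
  rw [star_dft_apply, star_dft_apply, mul_left_comm, ← Complex.exp_add]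
  congr 1
  rw [Complex.exp_eq_exp_iff_exists_int]
  obtain ⟨q, hq⟩ : ∃ q : ℕ, (next c : ℕ) + κ * q = (c : ℕ) + 1 :=
    ⟨_, Nat.mod_add_div ((c : ℕ) + 1) κ⟩
  have h1 : ((next c : ℕ) : ℂ) = (c : ℕ) + 1 - κ * q := by
    rw [eq_sub_iff_add_eq]
    exact_mod_cast hq
  refine ⟨-(q * (k : ℕ) : ℕ), ?_⟩
  rw [h1]
  push_cast
  field_simp
  ring

/-- The translation of a particle by one site is diagonal in the momentum modes. -/
lemma sum_annDag_mul_ann_next : ∑ c : Fin κ, (ann c)ᴴ * ann (next c) =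
    ∑ k : Fin κ, Complex.exp (2 * Real.pi * I * (k : ℕ) / κ) • ((mode k)ᴴ * mode k) := by
  have h : ∀ c : Fin κ, ann c = ∑ k, star (dft κ k c) • mode k := by
    intro c
    rw [mode_eq_modes]
    change _ = modes (dft κ)ᴴ (modes _ _) c
    rw [modes_modes, conjTranspose_mul_dft, modes_one]
  calc ∑ c : Fin κ, (ann c)ᴴ * ann (next c)
      = ∑ c : Fin κ, ∑ k : Fin κ, ∑ l : Fin κ,
          (Complex.exp (2 * Real.pi * I * (l : ℕ) / κ) * (dft κ k c * (dft κ)ᴴ c l)) •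
            ((mode k)ᴴ * mode l) := by
        refine Finset.sum_congr rfl fun c _ => ?_
        rw [h c, h (next c)]
        simp only [conjTranspose_sum, conjTranspose_smul, Finset.sum_mul_sum, star_star,
          smul_mul_smul_comm, star_dft_next, conjTranspose_apply, mul_left_comm]
    _ = ∑ k : Fin κ, ∑ l : Fin κ, (Complex.exp (2 * Real.pi * I * (l : ℕ) / κ) *
          (dft κ * (dft κ)ᴴ) k l) • ((mode k)ᴴ * mode l) := by
        rw [Finset.sum_comm]
        refine Finset.sum_congr rfl fun k _ => ?_
        rw [Finset.sum_comm]
        refine Finset.sum_congr rfl fun l _ => ?_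
        rw [Matrix.mul_apply, Finset.mul_sum, Finset.sum_smul]
    _ = _ := by
        refine Finset.sum_congr rfl fun k _ => ?_
        simp [dft_mul_conjTranspose, Matrix.one_apply]

theorem fermionRing_eq :
    fermionRing κ = ∑ k : Fin κ, ((energy k : ℝ) : ℂ) • ((mode k)ᴴ * mode k) := by
  have h1 : fermionRing κ = ∑ c : Fin κ, (ann c)ᴴ * ann (next c) +
      (∑ c : Fin κ, (ann c)ᴴ * ann (next c))ᴴ := by
    simp [fermionRing, hop, Finset.sum_add_distrib, conjTranspose_sum]
  rw [h1, sum_annDag_mul_ann_next, conjTranspose_sum, ← Finset.sum_add_distrib]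
  refine Finset.sum_congr rfl fun k _ => ?_
  rw [conjTranspose_smul, conjTranspose_mul, conjTranspose_conjTranspose, ← add_smul]
  congr 1
  rw [energy, RCLike.star_def, ← Complex.exp_conj]
  push_cast
  rw [Complex.cos]
  simp only [map_div₀, map_mul, map_ofNat, conj_ofReal, conj_I, map_natCast]
  rw [mul_div_cancel₀ _ two_ne_zero]
  congr 2 <;> ring

theorem FFFT_conj_fermionRing : FFFT κ * fermionRing κ * (FFFT κ)ᴴ =
    ∑ k : Fin κ, ((energy k : ℝ) : ℂ) • occupation k := by
  have h : ∀ k : Fin κ, FFFT κ * ((mode k)ᴴ * mode k) = occupation k * FFFT κ := by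
    intro k
    rw [← FFFT_conj_ann, conjTranspose_mul, conjTranspose_mul, conjTranspose_conjTranspose]
    calc FFFT κ * ((FFFT κ)ᴴ * ((ann k)ᴴ * FFFT κ) * ((FFFT κ)ᴴ * ann k * FFFT κ))
        = (FFFT κ * (FFFT κ)ᴴ) * (ann k)ᴴ * (FFFT κ * (FFFT κ)ᴴ) * ann k * FFFT κ := by
          simp only [mul_assoc]
      _ = _ := by
          rw [FFFT_mul_conjTranspose_self, one_mul, mul_one, ann_conjTranspose_mul_self]
  rw [fermionRing_eq, Finset.mul_sum, Finset.sum_mul]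
  refine Finset.sum_congr rfl fun k _ => ?_
  rw [mul_smul_comm, h, smul_mul_assoc, mul_assoc, FFFT_mul_conjTranspose_self, mul_one]

/-! ### Time evolution -/

/-- Intertwiners of Hamiltonians intertwine the evolutions. -/
lemma evolve_semiconj {P A B : Op κ} (t : ℝ) (h : P * A = B * P) :
    P * evolve t A = evolve t B * P := by
  have h1 : SemiconjBy P ((-(I * (t : ℂ))) • A) ((-(I * (t : ℂ))) • B) := by
    rw [SemiconjBy, mul_smul_comm, h, smul_mul_assoc]
  open scoped Norms.Operator in exact h1.exp_right

lemma commute_evolve {P A : Op κ} (t : ℝ) (h : Commute P A) : Commute P (evolve t A) :=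
  evolve_semiconj t h

/-- Hamiltonians that agree on the range of `Q` generate the same evolution there, provided that one
of them commutes with `Q`. -/
lemma evolve_mul_congr {A B Q : Op κ} (t : ℝ) (h : A * Q = B * Q) (hQ : Commute Q B) :
    evolve t A * Q = evolve t B * Q := by
  rw [← evolve_semiconj t (P := Q) (A := B) (B := A) (by rw [hQ, h])]
  exact commute_evolve t hQ

lemma evolve_conjTranspose {A : Op κ} (t : ℝ) (h : Aᴴ = A) : (evolve t A)ᴴ = evolve (-t) A := by
  rw [evolve, evolve, ← exp_conjTranspose, conjTranspose_smul, h]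
  congr 2
  simp

lemma evolve_zero_op (t : ℝ) : evolve t (0 : Op κ) = 1 := by
  rw [evolve, smul_zero, NormedSpace.exp_zero]

lemma evolve_mulVec_of_mulVec_eq_zero {A : Op κ} {ψ : State κ} (t : ℝ) (h : A *ᵥ ψ = 0) :
    evolve t A *ᵥ ψ = ψ := by
  -- The matrix whose column at `0` is `ψ` intertwines the zero Hamiltonian with `A`.
  have h1 := evolve_semiconj t (P := vecMulVec ψ (Pi.single 0 1)) (A := 0) (B := A)
    (by rw [mul_vecMulVec, h, mul_zero, zero_vecMulVec])
  rw [evolve_zero_op, mul_one, mul_vecMulVec] at h1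
  ext x
  have h2 := congrFun (congrFun h1 x) 0
  simpa [vecMulVec_apply] using h2.symm

/-- An eigenvector `P` of the commutator with `A`, with eigenvalue `r`, evolves by a phase. -/
lemma evolve_mul_of_commutator {A P : Op κ} (t r : ℝ) (h : A * P = P * A + (r : ℂ) • P) :
    evolve t A * P = Complex.exp (-(I * t * r)) • (P * evolve t A) := by
  have h1 : P * (A + (r : ℂ) • 1) = A * P := by
    rw [h, mul_add, mul_smul_comm, mul_one]
  rw [← evolve_semiconj t h1, ← mul_smul_comm]
  congr 1
  have h2 : NormedSpace.exp ((-(I * (t : ℂ)) * r) • (1 : Op κ)) =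
      Complex.exp (-(I * (t : ℂ)) * r) • 1 := by
    rw [smul_one_eq_diagonal, exp_diagonal, smul_one_eq_diagonal, Pi.exp_def,
      ← Complex.exp_eq_exp_ℂ]
  rw [evolve, smul_add, exp_add_of_commute, smul_smul, h2, mul_smul_comm, mul_one, evolve, neg_mul]
  exact ((Commute.one_right A).smul_right _).smul_left _ |>.smul_right _

lemma evolve_list_sum {ι : Type*} (t : ℝ) (L : List ι) (f : ι → Op κ)
    (h : ∀ i j, Commute (f i) (f j)) :
    evolve t (L.map f).sum = (L.map fun i => evolve t (f i)).prod := by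
  induction L with
  | nil => simp [evolve_zero_op]
  | cons i L ih =>
    rw [List.map_cons, List.sum_cons, List.map_cons, List.prod_cons, ← ih, evolve, smul_add,
      exp_add_of_commute, evolve, evolve]
    refine (Commute.smul_right ?_ _).smul_left _
    refine Commute.list_sum_right _ _ fun y hy => ?_
    obtain ⟨j, _, rfl⟩ := List.mem_map.1 hy
    exact h i j

lemma commute_occupation (c d : Fin κ) : Commute (occupation c) (occupation d) := by
  by_cases h : c = d
  · rw [h]
  · rw [← lower_conjTranspose_mul_self, ← lower_conjTranspose_mul_self, lower_conjTranspose,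
      lower_conjTranspose, lower, lower, onQubit_mul_onQubit, onQubit_mul_onQubit]
    exact onQubit_commute h _ _

lemma evolve_mul_smul (t r : ℝ) (A : Op κ) : evolve (t * r) A = evolve t ((r : ℂ) • A) := by
  rw [evolve, evolve, smul_smul]
  congr 2
  push_cast
  ring

lemma eval_qubitOp_rotLayer (β : ℝ) : Circuit.eval Gate.qubitOp [rotLayer κ β] =
    evolve β (∑ k : Fin κ, ((energy k : ℝ) : ℂ) • occupation k) := by
  rw [Fin.sum_univ_def, evolve_list_sum]
  · simp only [Circuit.eval, rotLayer, List.map_cons, List.map_nil, List.reverse_singleton,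
      List.prod_singleton, List.map_map]
    congr 1
    refine List.map_congr_left fun k _ => ?_
    rw [← evolve_mul_smul]
    rfl
  · exact fun i j => ((commute_occupation i j).smul_left _).smul_right _

theorem evolve_fermionRing (β : ℝ) : evolve β (fermionRing κ) =
    (FFFT κ)ᴴ * Circuit.eval Gate.qubitOp [rotLayer κ β] * FFFT κ := by
  rw [eval_qubitOp_rotLayer, evolve_semiconj β (B := fermionRing κ), mul_assoc,
    FFFT_conjTranspose_mul_self, mul_one]
  rw [← FFFT_conj_fermionRing, ← mul_assoc, ← mul_assoc, FFFT_conjTranspose_mul_self, one_mul]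

theorem evolve_xyRing_of_isOdd (hκ : 2 ≤ κ) (β : ℝ) {ψ : State κ} (h : IsOdd ψ) :
    evolve β (xyRing κ) *ᵥ ψ = evolve β (fermionRing κ) *ᵥ ψ := by
  have hc : Commute (1 - parity κ) (fermionRing κ) := by
    rw [parity_eq]
    exact (Commute.one_left _).sub_left (commute_weightFn_fermionRing _)
  exact mulVec_congr_of_isOdd (evolve_mul_congr β (xyRing_mul_eq_fermionRing_mul hκ) hc) h

/-! ### Gates as fermionic operators -/

/-- The fermionic Hamiltonian that generates a gate. -/
def Gate.ham : Gate κ → Op κ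
  | .rot j _ => (ann j)ᴴ * ann j
  | .xy i j _ => hop i j

/-- The angle of a gate. -/
def Gate.angle : Gate κ → ℝ
  | .rot _ θ => θ
  | .xy _ _ θ => θ

lemma Gate.fermionOp_eq (g : Gate κ) : g.fermionOp = evolve g.angle g.ham := by
  cases g <;> rfl

lemma annDag_mul_annDag (c d : Fin κ) : (ann c)ᴴ * (ann d)ᴴ = -((ann d)ᴴ * (ann c)ᴴ) := by
  have h := congrArg conjTranspose (isCAR_ann.2 d c)
  rw [conjTranspose_add, conjTranspose_mul, conjTranspose_mul, conjTranspose_zero] at h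
  exact eq_neg_of_add_eq_zero_left h

lemma annDag_mul_ann_mul_annDag (i j c : Fin κ) : (ann i)ᴴ * ann j * (ann c)ᴴ =
    (ann c)ᴴ * ((ann i)ᴴ * ann j) + if j = c then (ann i)ᴴ else 0 := by
  rw [mul_assoc, eq_sub_of_add_eq (isCAR_ann.1 j c), mul_sub, ← mul_assoc, annDag_mul_annDag i c,
    neg_mul, sub_neg_eq_add, mul_assoc, add_comm, mul_ite, mul_one, mul_zero]

lemma hop_mul_annDag (i j c : Fin κ) : hop i j * (ann c)ᴴ = (ann c)ᴴ * hop i j +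
    ((if j = c then (ann i)ᴴ else 0) + if i = c then (ann j)ᴴ else 0) := by
  rw [hop, add_mul, annDag_mul_ann_mul_annDag, annDag_mul_ann_mul_annDag, mul_add]
  abel

lemma Gate.ham_conjTranspose (g : Gate κ) : g.hamᴴ = g.ham := by
  cases g <;> simp [Gate.ham, hop, add_comm]

lemma Gate.commute_ham_annDag (g : Gate κ) {c : Fin κ} (hc : c ∉ g.qubits) :
    Commute g.ham (ann c)ᴴ := by
  cases g with
  | rot j θ =>
    have : j ≠ c := by
      rintro rfl
      simp [Gate.qubits] at hc
    rw [Commute, SemiconjBy, Gate.ham, annDag_mul_ann_mul_annDag, if_neg this, add_zero]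
  | xy i j θ =>
    simp only [Gate.qubits, List.mem_cons, List.not_mem_nil, or_false, not_or] at hc
    rw [Commute, SemiconjBy, Gate.ham, hop_mul_annDag, if_neg (Ne.symm hc.1),
      if_neg (Ne.symm hc.2), add_zero, add_zero]

lemma Gate.commute_ham_ann (g : Gate κ) {c : Fin κ} (hc : c ∉ g.qubits) :
    Commute g.ham (ann c) := by
  have h := congrArg conjTranspose (g.commute_ham_annDag hc)
  rw [conjTranspose_mul, conjTranspose_mul, conjTranspose_conjTranspose, g.ham_conjTranspose] at h
  exact h.symm

lemma Gate.commute_ham_ham {g g' : Gate κ} (h : g.qubits.Disjoint g'.qubits) :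
    Commute g.ham g'.ham := by
  have key : ∀ c ∈ g'.qubits, Commute g.ham (ann c)ᴴ ∧ Commute g.ham (ann c) := fun c hc =>
    ⟨g.commute_ham_annDag fun h1 => h h1 hc, g.commute_ham_ann fun h1 => h h1 hc⟩
  cases g' with
  | rot j θ =>
    have hj := key j (by simp [Gate.qubits])
    exact hj.1.mul_right hj.2
  | xy i j θ =>
    have hi := key i (by simp [Gate.qubits])
    have hj := key j (by simp [Gate.qubits])
    exact (hi.1.mul_right hj.2).add_right (hj.1.mul_right hi.2)

lemma Gate.commute_fermionOp {g g' : Gate κ} (h : g.qubits.Disjoint g'.qubits) :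
    Commute g.fermionOp g'.fermionOp := by
  rw [Gate.fermionOp_eq, Gate.fermionOp_eq]
  exact commute_evolve _ (commute_evolve _ (Gate.commute_ham_ham h).symm).symm

lemma Gate.dagger_fermionOp (g : Gate κ) : g.dagger.fermionOp = g.fermionOpᴴ := by
  rw [g.fermionOp_eq, evolve_conjTranspose _ g.ham_conjTranspose]
  cases g <;> rfl

lemma Gate.fermionOp_mulVec_vacuum (g : Gate κ) : g.fermionOp *ᵥ vacuum κ = vacuum κ := by
  rw [g.fermionOp_eq]
  apply evolve_mulVec_of_mulVec_eq_zero
  cases g <;> simp [Gate.ham, hop, add_mulVec, ← mulVec_mulVec, ann_mulVec_vacuum]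

lemma Gate.commute_weightFn_fermionOp (g : Gate κ) (f : ℕ → ℂ) :
    Commute (weightFn f) g.fermionOp := by
  rw [g.fermionOp_eq]
  apply commute_evolve
  cases g with
  | rot j θ => exact commute_weightFn_annDag_mul_ann j j f
  | xy i j θ => exact commute_weightFn_hop i j f

lemma Gate.dagger_qubits (g : Gate κ) : g.dagger.qubits = g.qubits := by
  cases g <;> rfl

/-! ### Circuits -/

namespace Circuit

lemma eval_eq (f : Gate κ → Op κ) (W : Circuit κ) :
    W.eval f = (W.reverse.map fun L => (L.map f).prod).prod := by
  rw [eval, List.map_reverse]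

lemma eval_append (f : Gate κ → Op κ) (W W' : Circuit κ) :
    Circuit.eval f (W ++ W') = Circuit.eval f W' * Circuit.eval f W := by
  simp [eval]

lemma eval_cons (f : Gate κ → Op κ) (L : List (Gate κ)) (W : Circuit κ) :
    Circuit.eval f (L :: W) = Circuit.eval f W * (L.map f).prod := by
  simp [eval]

lemma Valid.append {W W' : Circuit κ} (h : W.Valid) (h' : W'.Valid) :
    Circuit.Valid (W ++ W') := by
  intro L hL
  rcases List.mem_append.1 hL with hL | hL
  · exact h L hL
  · exact h' L hL

lemma Valid.dagger {W : Circuit κ} (h : W.Valid) : W.dagger.Valid := by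
  intro L hL
  rw [Circuit.dagger, List.mem_reverse, List.mem_map] at hL
  obtain ⟨L', hL', rfl⟩ := hL
  rw [List.flatMap_map]
  simp only [Gate.dagger_qubits]
  exact h L' hL'

/-- The gates of a layer commute, so that the order of the gates in the inverse of a layer does
not matter. -/
lemma prod_dagger {L : List (Gate κ)} (h : (L.flatMap Gate.qubits).Nodup) :
    ((L.map Gate.dagger).map Gate.fermionOp).prod = ((L.map Gate.fermionOp).prod)ᴴ := by
  induction L with
  | nil => simp
  | cons g L ih =>
    rw [List.flatMap_cons, List.nodup_append'] at h
    have hc : Commute g.fermionOp (L.map Gate.fermionOp).prod := by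
      refine Commute.list_prod_right _ _ fun y hy => ?_
      obtain ⟨g', hg', rfl⟩ := List.mem_map.1 hy
      refine Gate.commute_fermionOp fun c h1 h2 => h.2.2 h1 ?_
      exact List.mem_flatMap.2 ⟨g', hg', h2⟩
    rw [List.map_cons, List.map_cons, List.prod_cons, ih h.2.1, List.map_cons, List.prod_cons,
      hc.eq, conjTranspose_mul, Gate.dagger_fermionOp]

lemma eval_fermionOp_dagger {W : Circuit κ} (h : W.Valid) :
    W.dagger.eval Gate.fermionOp = (W.eval Gate.fermionOp)ᴴ := by
  induction W with
  | nil => simp [Circuit.dagger, eval]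
  | cons L W ih =>
    have hW : Circuit.Valid W := fun L' hL' => h L' (List.mem_cons_of_mem _ hL')
    have h1 : Circuit.dagger (L :: W) = Circuit.dagger W ++ [L.map Gate.dagger] := by
      simp [Circuit.dagger]
    rw [h1, eval_append, ih hW, eval_cons, eval_cons, conjTranspose_mul,
      prod_dagger (h L List.mem_cons_self)]
    simp [eval]

end Circuit

/-! ### Qubit gates and fermionic gates agree on the feasible subspace -/

/-- The projection onto the feasible subspace. -/
def feasibleProj (κ : ℕ) : Op κ := weightFn fun n => if n = 1 then 1 else 0

lemma feasibleProj_mulVec {ψ : State κ} (h : IsFeasible ψ) : feasibleProj κ *ᵥ ψ = ψ := by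
  ext x
  rw [feasibleProj, weightFn, mulVec_diagonal]
  by_cases hx : ψ x = 0
  · simp [hx]
  · simp [h x hx]

lemma IsFeasible.isOdd {ψ : State κ} (h : IsFeasible ψ) : IsOdd ψ := by
  ext x
  rw [parity, mulVec_diagonal]
  by_cases hx : ψ x = 0
  · simp [hx]
  · simp [h x hx]

/-- With at most one particle present, the Jordan–Wigner strings act trivially. -/
lemma annDag_mul_ann_mul_feasibleProj (i j : Fin κ) :
    (ann i)ᴴ * ann j * feasibleProj κ = (lower i)ᴴ * lower j * feasibleProj κ := by
  have hV : ∀ c : Fin κ, jwString c * weightFn (fun n => if n + 1 = 1 then 1 else 0) =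
      weightFn fun n => if n + 1 = 1 then 1 else 0 := by
    intro c
    rw [jwString, weightFn, diagonal_mul_diagonal]
    congr 1
    ext x
    by_cases hx : hammingWeight x = 0
    · rw [Finset.card_eq_zero.2, pow_zero, one_mul]
      rw [hammingWeight, Finset.card_eq_zero] at hx
      refine Finset.eq_empty_of_forall_notMem fun e he => ?_
      have : e ∈ Finset.univ.filter fun c => x c = 1 := by
        simp only [Finset.mem_filter, Finset.mem_univ, true_and] at he ⊢
        exact he.2
      rw [hx] at this
      simp at this
    · simp [hx]
  rw [ann_conjTranspose, ann_eq, feasibleProj, mul_assoc, mul_assoc, mul_assoc,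
    lower_mul_weightFn, ← mul_assoc (jwString j), hV, ← mul_assoc (jwString i), hV, mul_assoc,
    lower_mul_weightFn]

lemma Gate.qubitOp_mul_feasibleProj {g : Gate κ} (h : g.qubits.Nodup) :
    g.qubitOp * feasibleProj κ = g.fermionOp * feasibleProj κ := by
  cases g with
  | rot j θ => rw [Gate.qubitOp, Gate.fermionOp, ann_conjTranspose_mul_self]
  | xy i j θ =>
    have hij : i ≠ j := by simpa [Gate.qubits] using h
    refine evolve_mul_congr θ ?_ (commute_weightFn_hop i j _)
    rw [half_xyPair hij, hop, add_mul, add_mul, annDag_mul_ann_mul_feasibleProj,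
      annDag_mul_ann_mul_feasibleProj]

lemma list_prod_mul_congr {ι : Type*} (L : List ι) (f f' : ι → Op κ) {P : Op κ}
    (h : ∀ i ∈ L, f i * P = f' i * P) (hP : ∀ i ∈ L, Commute P (f' i)) :
    (L.map f).prod * P = (L.map f').prod * P := by
  induction L with
  | nil => rfl
  | cons i L ih =>
    have hc : Commute P (L.map f').prod := by
      refine Commute.list_prod_right _ _ fun y hy => ?_
      obtain ⟨j, hj, rfl⟩ := List.mem_map.1 hy
      exact hP j (List.mem_cons_of_mem _ hj)
    rw [List.map_cons, List.map_cons, List.prod_cons, List.prod_cons, mul_assoc,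
      ih (fun j hj => h j (List.mem_cons_of_mem _ hj))
        (fun j hj => hP j (List.mem_cons_of_mem _ hj)),
      ← hc.eq, ← mul_assoc, h i List.mem_cons_self, mul_assoc, hc.eq, mul_assoc]

theorem Circuit.eval_qubitOp_mul_feasibleProj {W : Circuit κ} (h : W.Valid) :
    W.eval Gate.qubitOp * feasibleProj κ = W.eval Gate.fermionOp * feasibleProj κ := by
  rw [Circuit.eval_eq, Circuit.eval_eq]
  refine list_prod_mul_congr _ _ _ (fun L hL => ?_) fun L _ => ?_
  · refine list_prod_mul_congr _ _ _ (fun g hg => ?_) fun g _ =>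
      g.commute_weightFn_fermionOp _
    exact Gate.qubitOp_mul_feasibleProj
      ((List.nodup_flatMap.1 (h L (List.mem_reverse.1 hL))).1 g hg)
  · refine Commute.list_prod_right _ _ fun y hy => ?_
    obtain ⟨g, _, rfl⟩ := List.mem_map.1 hy
    exact g.commute_weightFn_fermionOp _

lemma Circuit.eval_qubitOp_mulVec {W : Circuit κ} (h : W.Valid) {ψ : State κ}
    (hψ : IsFeasible ψ) : W.eval Gate.qubitOp *ᵥ ψ = W.eval Gate.fermionOp *ᵥ ψ := by
  have h1 := congrArg (· *ᵥ ψ) (Circuit.eval_qubitOp_mul_feasibleProj h)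
  simpa only [← mulVec_mulVec, feasibleProj_mulVec hψ] using h1

/-! ### The mixer circuit -/

lemma valid_rotations (l : List (Fin κ)) (hl : l.Nodup) (φ : Fin κ → ℝ) :
    ((l.map fun j => Gate.rot j (φ j)).flatMap Gate.qubits).Nodup := by
  rw [List.flatMap_map]
  simpa [Gate.qubits] using hl

lemma valid_mixer {W : Circuit κ} (h : W.Valid) (β : ℝ) : (mixer W β).Valid := by
  refine (h.append fun L hL => ?_).append h.dagger
  rw [List.mem_singleton.1 hL]
  exact valid_rotations _ (List.nodup_finRange κ) _

lemma depth_mixer (W : Circuit κ) (β : ℝ) : (mixer W β).depth = 2 * W.depth + 1 := by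
  simp [mixer, Circuit.depth, Circuit.dagger]
  ring

lemma eval_fermionOp_mixer {W : Circuit κ} (h : W.Valid)
    (hW : W.eval Gate.fermionOp = FFFT κ) (β : ℝ) :
    (mixer W β).eval Gate.fermionOp = evolve β (fermionRing κ) := by
  have hrot : Circuit.eval Gate.fermionOp [rotLayer κ β] =
      Circuit.eval Gate.qubitOp [rotLayer κ β] := by
    simp [Circuit.eval, rotLayer, Function.comp_def, Gate.fermionOp, Gate.qubitOp,
      ann_conjTranspose_mul_self]
  rw [mixer, Circuit.eval_append, Circuit.eval_append, Circuit.eval_fermionOp_dagger h, hW, hrot,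
    evolve_fermionRing, mul_assoc]

/-! ### Circuits as single-particle transformations -/

/-- The creation operator `∑_d v_d a_d†` of a particle with wave function `v`. -/
def cre (v : Fin κ → ℂ) : Op κ := ∑ d, v d • (ann d)ᴴ

/-- The action of a gate on the wave function of a single particle: a phase on one mode, or a
beam splitter between two modes. -/
def Gate.act : Gate κ → (Fin κ → ℂ) → Fin κ → ℂ
  | .rot j θ, v => fun d => if d = j then Complex.exp (-(I * θ)) * v d else v d
  | .xy i j θ, v => fun d =>
      if d = i then (Real.cos θ : ℂ) * v i - I * (Real.sin θ : ℂ) * v j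
      else if d = j then (Real.cos θ : ℂ) * v j - I * (Real.sin θ : ℂ) * v i
      else v d

/-- The action of a layer on the wave function of a single particle. -/
def layerAct (L : List (Gate κ)) (v : Fin κ → ℂ) : Fin κ → ℂ := L.foldr Gate.act v

/-- The action of a circuit on the wave function of a single particle. -/
def Circuit.act (W : Circuit κ) (v : Fin κ → ℂ) : Fin κ → ℂ :=
  W.foldl (fun u L => layerAct L u) v

lemma Gate.fermionOp_mul_annDag (g : Gate κ) {d : Fin κ} (hd : d ∉ g.qubits) :
    g.fermionOp * (ann d)ᴴ = (ann d)ᴴ * g.fermionOp := by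
  rw [g.fermionOp_eq]
  exact (commute_evolve _ (g.commute_ham_annDag hd).symm).symm

lemma Gate.rot_mul_annDag (j : Fin κ) (θ : ℝ) : (Gate.rot j θ).fermionOp * (ann j)ᴴ =
    Complex.exp (-(I * θ)) • ((ann j)ᴴ * (Gate.rot j θ).fermionOp) := by
  have h := evolve_mul_of_commutator (A := (ann j)ᴴ * ann j) (P := (ann j)ᴴ) θ 1
    (by rw [annDag_mul_ann_mul_annDag]; simp)
  rw [ofReal_one, mul_one] at h
  exact h

/-- `a_i† ± a_j†` are eigenvectors of the commutator with the hopping Hamiltonian, with eigenvalues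
`±1`. -/
lemma Gate.xy_mul_annDag {i j : Fin κ} (hij : i ≠ j) (θ : ℝ) (p q : ℂ) :
    (Gate.xy i j θ).fermionOp * (p • (ann i)ᴴ + q • (ann j)ᴴ) =
      (((Real.cos θ : ℂ) * p - I * (Real.sin θ : ℂ) * q) • (ann i)ᴴ +
        ((Real.cos θ : ℂ) * q - I * (Real.sin θ : ℂ) * p) • (ann j)ᴴ) *
      (Gate.xy i j θ).fermionOp := by
  have h1 := evolve_mul_of_commutator (A := hop i j) (P := (ann i)ᴴ + (ann j)ᴴ) θ 1 (by
    rw [mul_add, hop_mul_annDag, hop_mul_annDag, add_mul]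
    simp only [hij, hij.symm, if_true, if_false]
    push_cast
    module)
  have h2 := evolve_mul_of_commutator (A := hop i j) (P := (ann i)ᴴ - (ann j)ᴴ) θ (-1) (by
    rw [mul_sub, hop_mul_annDag, hop_mul_annDag, sub_mul]
    simp only [hij, hij.symm, if_true, if_false]
    push_cast
    module)
  have hc : (Real.cos θ : ℂ) = (Complex.exp (-(I * θ * (1 : ℝ))) +
      Complex.exp (-(I * θ * (-1 : ℝ)))) / 2 := by
    rw [Complex.ofReal_cos, Complex.cos, add_comm]
    congr 3 <;> push_cast <;> ring
  have hs : I * (Real.sin θ : ℂ) = (Complex.exp (-(I * θ * (-1 : ℝ))) -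
      Complex.exp (-(I * θ * (1 : ℝ)))) / 2 := by
    have e1 : -(I * θ * (1 : ℝ)) = -(θ : ℂ) * I := by push_cast; ring
    have e2 : -(I * θ * (-1 : ℝ)) = (θ : ℂ) * I := by push_cast; ring
    rw [Complex.ofReal_sin, Complex.sin, e1, e2]
    linear_combination ((Complex.exp (-θ * I) - Complex.exp (θ * I)) / 2) * I_mul_I
  rw [hc, hs, Gate.fermionOp]
  rw [mul_add, add_mul] at h1
  rw [mul_sub, sub_mul] at h2
  simp only [mul_add, add_mul, mul_smul_comm, smul_mul_assoc]
  linear_combination (norm := module) ((p + q) / 2) • h1 + ((p - q) / 2) • h2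

theorem Gate.fermionOp_mul_cre {g : Gate κ} (hg : g.qubits.Nodup) (v : Fin κ → ℂ) :
    g.fermionOp * cre v = cre (g.act v) * g.fermionOp := by
  cases g with
  | rot j θ =>
    rw [cre, cre, Finset.mul_sum, Finset.sum_mul]
    refine Finset.sum_congr rfl fun d _ => ?_
    by_cases hd : d = j
    · subst hd
      rw [mul_smul_comm, Gate.rot_mul_annDag, smul_smul, smul_mul_assoc, mul_comm]
      simp [Gate.act]
    · rw [mul_smul_comm, Gate.fermionOp_mul_annDag _ (by simpa [Gate.qubits] using hd),
        smul_mul_assoc]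
      simp [Gate.act, hd]
  | xy i j θ =>
    have hij : i ≠ j := by simpa [Gate.qubits] using hg
    have split : ∀ u : Fin κ → ℂ, cre u = (u i • (ann i)ᴴ + u j • (ann j)ᴴ) +
        ∑ d ∈ (Finset.univ.erase i).erase j, u d • (ann d)ᴴ := by
      intro u
      rw [add_assoc, Finset.add_sum_erase _ (fun d => u d • (ann d)ᴴ), Finset.add_sum_erase _
        (fun d => u d • (ann d)ᴴ) (Finset.mem_univ i), cre]
      simp [hij.symm]
    rw [split v, split (Gate.act _ v), mul_add, add_mul, Gate.xy_mul_annDag hij]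
    congr 1
    · simp [Gate.act, hij.symm]
    · rw [Finset.mul_sum, Finset.sum_mul]
      refine Finset.sum_congr rfl fun d hd => ?_
      simp only [Finset.mem_erase, Finset.mem_univ, and_true] at hd
      rw [mul_smul_comm, Gate.fermionOp_mul_annDag _ (by simp [Gate.qubits, hd.1, hd.2]),
        smul_mul_assoc]
      simp [Gate.act, hd.1, hd.2]

lemma layer_mul_cre {L : List (Gate κ)} (h : (L.flatMap Gate.qubits).Nodup) (v : Fin κ → ℂ) :
    (L.map Gate.fermionOp).prod * cre v = cre (layerAct L v) * (L.map Gate.fermionOp).prod := by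
  have hg := (List.nodup_flatMap.1 h).1
  clear h
  induction L with
  | nil => simp [layerAct]
  | cons g L ih =>
    rw [List.map_cons, List.prod_cons, mul_assoc,
      ih fun g' hg' => hg g' (List.mem_cons_of_mem _ hg'), ← mul_assoc,
      Gate.fermionOp_mul_cre (hg g List.mem_cons_self), mul_assoc]
    rfl

namespace Circuit

lemma eval_mul_cre {W : Circuit κ} (h : W.Valid) (v : Fin κ → ℂ) :
    W.eval Gate.fermionOp * cre v = cre (W.act v) * W.eval Gate.fermionOp := by
  induction W generalizing v with
  | nil => simp [eval, act]
  | cons L W ih =>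
    have hW : Circuit.Valid W := fun L' hL' => h L' (List.mem_cons_of_mem _ hL')
    rw [eval_cons, mul_assoc, layer_mul_cre (h L List.mem_cons_self), ← mul_assoc, ih hW, mul_assoc]
    rfl

lemma eval_mulVec_vacuum (W : Circuit κ) : W.eval Gate.fermionOp *ᵥ vacuum κ = vacuum κ := by
  have key : ∀ L : List (Op κ), (∀ A ∈ L, A *ᵥ vacuum κ = vacuum κ) →
      L.prod *ᵥ vacuum κ = vacuum κ := by
    intro L hL
    induction L with
    | nil => simp
    | cons A L ih =>
      rw [List.prod_cons, ← mulVec_mulVec, ih fun B hB => hL B (List.mem_cons_of_mem _ hB),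
        hL A List.mem_cons_self]
  rw [eval_eq]
  refine key _ fun A hA => ?_
  obtain ⟨L, _, rfl⟩ := List.mem_map.1 hA
  refine key _ fun B hB => ?_
  obtain ⟨g, _, rfl⟩ := List.mem_map.1 hB
  exact g.fermionOp_mulVec_vacuum

lemma act_append (W W' : Circuit κ) (v : Fin κ → ℂ) :
    Circuit.act (W ++ W') v = Circuit.act W' (Circuit.act W v) := by
  simp [act]

/-- A circuit whose action on a single particle is the discrete Fourier transform implements the
fermionic Fourier transform on the whole Fock space: it fixes the vacuum, and transforms
the creation operators in the same way. -/
theorem eval_eq_FFFT {W : Circuit κ} (h : W.Valid)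
    (hW : ∀ c k, W.act (Pi.single c 1) k = dft κ k c) : W.eval Gate.fermionOp = FFFT κ := by
  have h1 : ∀ c, W.eval Gate.fermionOp * (ann c)ᴴ = (image c)ᴴ * W.eval Gate.fermionOp := by
    intro c
    have h2 := eval_mul_cre h (Pi.single c 1)
    have h3 : cre (Pi.single c 1) = (ann c)ᴴ := by
      rw [cre, Finset.sum_eq_single c]
      · simp
      · intro d _ hd
        simp [hd]
      · simp
    have h4 : cre (W.act (Pi.single c 1)) = (image c)ᴴ := by
      rw [image_eq_modes, modes, conjTranspose_sum, cre]
      simp [hW]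
    rwa [h3, h4] at h2
  refine op_ext fun x => ?_
  rw [FFFT_mulVec_single, ← fockState_ann_ones]
  generalize ones x = l
  induction l with
  | nil => rw [fockState_nil, fockState_nil, eval_mulVec_vacuum]
  | cons c l ih => rw [fockState_cons, fockState_cons, mulVec_mulVec, h1, ← mulVec_mulVec, ih]

end Circuit

/-! ### Phase layers and beam splitter layers -/

/-- A layer of `Z` rotations by the angles `φ`. -/
def phaseLayer (φ : Fin κ → ℝ) : List (Gate κ) :=
  (List.finRange κ).map fun j => Gate.rot j (φ j)

/-- For an involution `τ`, the layer of interactions by the angle `θ` between all pairs of distinct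
sites that `τ` exchanges. -/
def pairLayer (τ : Fin κ → Fin κ) (θ : ℝ) : List (Gate κ) :=
  ((List.finRange κ).filter fun i => i < τ i).map fun i => Gate.xy i (τ i) θ

lemma layerAct_phaseLayer (φ : Fin κ → ℝ) (v : Fin κ → ℂ) (d : Fin κ) :
    layerAct (phaseLayer φ) v d = Complex.exp (-(I * φ d)) * v d := by
  have key : ∀ l : List (Fin κ), l.Nodup → layerAct (l.map fun j => Gate.rot j (φ j)) v d =
      if d ∈ l then Complex.exp (-(I * φ d)) * v d else v d := by
    intro l hl
    induction l with
    | nil => simp [layerAct]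
    | cons j l ih =>
      rw [List.nodup_cons] at hl
      change (if d = j then _ * layerAct _ v d else layerAct _ v d) = _
      rw [ih hl.2]
      by_cases hd : d = j
      · subst hd
        simp [hl.1]
      · simp [hd]
  rw [phaseLayer, key _ (List.nodup_finRange κ), if_pos (List.mem_finRange d)]

lemma valid_phaseLayer (φ : Fin κ → ℝ) : ((phaseLayer φ).flatMap Gate.qubits).Nodup :=
  valid_rotations _ (List.nodup_finRange κ) φ

lemma valid_pairLayer {τ : Fin κ → Fin κ} (hτ : Function.Involutive τ) (θ : ℝ) :
    ((pairLayer τ θ).flatMap Gate.qubits).Nodup := by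
  rw [pairLayer, List.flatMap_map, List.nodup_flatMap]
  constructor
  · intro i hi
    have : i < τ i := by simpa using hi
    simpa [Gate.qubits] using this.ne
  · have hnd := (List.nodup_finRange κ).filter fun i => decide (i < τ i)
    refine List.Pairwise.imp_of_mem ?_ hnd
    intro i j hi hj hij
    have hi' : i < τ i := by simpa using hi
    have hj' : j < τ j := by simpa using hj
    have h1 : ∀ a b, a < τ a → b < τ b → a ≠ τ b := by
      rintro a b ha hb rfl
      rw [hτ b] at ha
      exact lt_asymm ha hb
    simp only [Function.onFun, Gate.qubits, List.disjoint_cons_left, List.mem_cons,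
      List.not_mem_nil, or_false, not_or, List.disjoint_nil_left, and_true]
    exact ⟨⟨hij, h1 i j hi' hj'⟩, (h1 j i hj' hi').symm, fun h => hij (hτ.injective h)⟩

lemma layerAct_pairLayer {τ : Fin κ → Fin κ} (hτ : Function.Involutive τ) (θ : ℝ)
    (v : Fin κ → ℂ) (d : Fin κ) : layerAct (pairLayer τ θ) v d =
      if τ d = d then v d else (Real.cos θ : ℂ) * v d - I * (Real.sin θ : ℂ) * v (τ d) := by
  have key : ∀ l : List (Fin κ), l.Nodup → (∀ i ∈ l, i < τ i) → ∀ d,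
      layerAct (l.map fun i => Gate.xy i (τ i) θ) v d = if d ∈ l ∨ τ d ∈ l then
        (Real.cos θ : ℂ) * v d - I * (Real.sin θ : ℂ) * v (τ d) else v d := by
    intro l hl hlt
    induction l with
    | nil => simp [layerAct]
    | cons i l ih =>
      rw [List.nodup_cons] at hl
      have hi := hlt i List.mem_cons_self
      have ih' := ih hl.2 fun j hj => hlt j (List.mem_cons_of_mem _ hj)
      have hτi : τ i ∉ l := fun h => by
        have := hlt _ (List.mem_cons_of_mem _ h)
        rw [hτ i] at this
        exact lt_asymm this hi
      intro d
      set w := layerAct (l.map fun i => Gate.xy i (τ i) θ) v with hw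
      change (if d = i then _ * w i - _ * w (τ i) else if d = τ i then _ * w (τ i) - _ * w i
        else w d) = _
      have hwi : w i = v i := by rw [ih', if_neg (by simp [hl.1, hτi])]
      have hwτ : w (τ i) = v (τ i) := by rw [ih', if_neg (by simp [hl.1, hτi, hτ i])]
      rw [hwi, hwτ]
      by_cases hd : d = i
      · subst hd
        simp
      · by_cases hd' : d = τ i
        · subst hd'
          rw [if_neg hd, if_pos rfl, hτ i, if_pos (by simp)]
        · have hd'' : τ d ≠ i := fun h => hd' (by rw [← h, hτ d])
          rw [if_neg hd, if_neg hd', ih']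
          simp [hd, hd'']
  rw [pairLayer, key _ ((List.nodup_finRange κ).filter _) (by simp)]
  simp only [List.mem_filter, List.mem_finRange, true_and, decide_eq_true_eq, hτ d]
  by_cases h : τ d = d
  · simp [h]
  · rw [if_neg h, if_pos (lt_or_gt_of_ne (Ne.symm h))]

/-! ### The fast Fourier transform on `2 ^ m` modes -/

variable {m : ℕ}

/-- The number encoded by the bits of `z` strictly below position `t`. -/
def lowBits (t : ℕ) (z : Fin m → Fin 2) : ℕ :=
  ∑ i : Fin m, if (i : ℕ) < t then (z i : ℕ) * 2 ^ (i : ℕ) else 0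

/-- The factor that output bit `b` at position `l` contributes to the matrix element of the Fourier
transform with input bits `x`. Input bits above position `l` do not matter, since they change the
phase by a multiple of `2π`. -/
def fftFactor (l : Fin m) (x : Fin m → Fin 2) (b : Fin 2) : ℂ :=
  ((√2 / 2 : ℝ) : ℂ) *
    Complex.exp (-(Real.pi * I * (b : ℕ) * ((x l : ℕ) + (lowBits l x : ℕ) / 2 ^ (l : ℕ))))

/-- The amplitude from input bits `x` to the bits `z` when the positions from `t` on have been
transformed to output bits and those below `t` still hold input bits. -/
def fftAmp (t : ℕ) (x z : Fin m → Fin 2) : ℂ :=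
  ∏ l : Fin m, if t ≤ (l : ℕ) then fftFactor l x (z l) else if z l = x l then 1 else 0

/-- Flip bit `t` of a bit string. -/
def flipBit (t : Fin m) (z : Fin m → Fin 2) : Fin m → Fin 2 := Function.update z t (1 - z t)

lemma flipBit_flipBit (t : Fin m) (z : Fin m → Fin 2) : flipBit t (flipBit t z) = z := by
  have : ∀ b : Fin 2, 1 - (1 - b) = b := by decide
  simp [flipBit, this]

lemma flipBit_ne (t : Fin m) (z : Fin m → Fin 2) : flipBit t z ≠ z := by
  have : ∀ b : Fin 2, 1 - b ≠ b := by decide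
  intro h
  have h' := congrFun h t
  rw [flipBit, Function.update_self] at h'
  exact this _ h'

/-- The sites are labelled by their binary digits. -/
def bits (m : ℕ) : (Fin m → Fin 2) ≃ Fin (2 ^ m) := finFunctionFinEquiv

/-- A permutation of bit strings as a permutation of sites. -/
def onSites (f : (Fin m → Fin 2) → Fin m → Fin 2) (d : Fin (2 ^ m)) : Fin (2 ^ m) :=
  bits m (f ((bits m).symm d))

lemma onSites_bits (f : (Fin m → Fin 2) → Fin m → Fin 2) (z : Fin m → Fin 2) :
    onSites f (bits m z) = bits m (f z) := by
  simp [onSites]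

lemma involutive_onSites {f : (Fin m → Fin 2) → Fin m → Fin 2} (hf : Function.Involutive f) :
    Function.Involutive (onSites f) := by
  intro d
  simp [onSites, hf _]

/-- One butterfly stage: a Hadamard transformation of bit `t`, followed by the twiddle phases. The
Hadamard matrix is the balanced beam splitter between the phases `diag(1, i)`. -/
def fftStage (t : Fin m) : Circuit (2 ^ m) :=
  [phaseLayer fun d => if (bits m).symm d t = 1 then -(Real.pi / 2) else 0,
    pairLayer (onSites (flipBit t)) (Real.pi / 4),
    phaseLayer fun d => if (bits m).symm d t = 1 then
      -(Real.pi / 2) + Real.pi * (lowBits t ((bits m).symm d) / 2 ^ (t : ℕ)) else 0]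

lemma exp_neg_I_mul_neg_pi_div_two :
    Complex.exp (-(I * ((-(Real.pi / 2) : ℝ) : ℂ))) = I := by
  have : -(I * ((-(Real.pi / 2) : ℝ) : ℂ)) = Real.pi / 2 * I := by
    push_cast
    ring
  rw [this, Complex.exp_pi_div_two_mul_I]

lemma act_fftStage (t : Fin m) (v : Fin (2 ^ m) → ℂ) (z : Fin m → Fin 2) :
    Circuit.act (fftStage t) v (bits m z) = ((√2 / 2 : ℝ) : ℂ) *
      if z t = 1 then Complex.exp (-(Real.pi * I * ((lowBits t z : ℕ) / 2 ^ (t : ℕ)))) *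
        (v (bits m (flipBit t z)) - v (bits m z))
      else v (bits m z) + v (bits m (flipBit t z)) := by
  have hne : onSites (flipBit t) (bits m z) ≠ bits m z := by
    rw [onSites_bits, Ne, (bits m).injective.eq_iff]
    exact flipBit_ne t z
  have hflip : flipBit t z t = 1 - z t := by rw [flipBit, Function.update_self]
  simp only [fftStage, Circuit.act, List.foldl_cons, List.foldl_nil]
  rw [layerAct_phaseLayer, layerAct_pairLayer (involutive_onSites (flipBit_flipBit t)), if_neg hne,
    layerAct_phaseLayer, layerAct_phaseLayer, onSites_bits, Real.cos_pi_div_four,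
    Real.sin_pi_div_four]
  simp only [Equiv.symm_apply_apply, hflip]
  have hz : z t = 0 ∨ z t = 1 := by omega
  rcases hz with hz | hz
  · simp only [hz, sub_zero, zero_ne_one, if_true, if_false, exp_neg_I_mul_neg_pi_div_two]
    simp only [ofReal_zero, mul_zero, neg_zero, Complex.exp_zero, one_mul]
    linear_combination (-((√2 / 2 : ℝ) : ℂ) * v (bits m (flipBit t z))) * I_mul_I
  · simp only [hz, sub_self, zero_ne_one, if_true, if_false, exp_neg_I_mul_neg_pi_div_two]
    have h1 : Complex.exp (-(I * ((-(Real.pi / 2) +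
        Real.pi * (lowBits t z / 2 ^ (t : ℕ)) : ℝ) : ℂ))) =
        I * Complex.exp (-(Real.pi * I * ((lowBits t z : ℕ) / 2 ^ (t : ℕ)))) := by
      have h2 : -(I * ((-(Real.pi / 2) + Real.pi * (lowBits t z / 2 ^ (t : ℕ)) : ℝ) : ℂ)) =
          Real.pi / 2 * I + -(Real.pi * I * ((lowBits t z : ℕ) / 2 ^ (t : ℕ))) := by
        push_cast
        ring
      rw [h2, Complex.exp_add, Complex.exp_pi_div_two_mul_I]
    rw [h1]
    simp only [ofReal_zero, mul_zero, neg_zero, Complex.exp_zero, one_mul]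
    linear_combination (((√2 / 2 : ℝ) : ℂ) *
      Complex.exp (-(Real.pi * I * ((lowBits t z : ℕ) / 2 ^ (t : ℕ)))) *
      (v (bits m z) - v (bits m (flipBit t z)))) * I_mul_I

lemma valid_fftStage (t : Fin m) : (fftStage t).Valid := by
  intro L hL
  simp only [fftStage, List.mem_cons, List.not_mem_nil, or_false] at hL
  rcases hL with rfl | rfl | rfl
  · exact valid_phaseLayer _
  · exact valid_pairLayer (involutive_onSites (flipBit_flipBit t)) _
  · exact valid_phaseLayer _

/-- A butterfly stage transforms one more bit. -/
lemma act_fftStage_fftAmp (t : Fin m) (x : Fin m → Fin 2) {v : Fin (2 ^ m) → ℂ}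
    (hv : ∀ z, v (bits m z) = fftAmp (t + 1) x z) (z : Fin m → Fin 2) :
    Circuit.act (fftStage t) v (bits m z) = fftAmp t x z := by
  set R : ℂ := ∏ l ∈ Finset.univ.erase t,
    if (t : ℕ) ≤ (l : ℕ) then fftFactor l x (z l) else if z l = x l then 1 else 0 with hR
  have hamp : fftAmp t x z = fftFactor t x (z t) * R := by
    rw [fftAmp, ← Finset.mul_prod_erase _ _ (Finset.mem_univ t), if_pos le_rfl]
  have hamp' : ∀ b, fftAmp (t + 1) x (Function.update z t b) =
      (if b = x t then 1 else 0) * R := by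
    intro b
    rw [fftAmp, ← Finset.mul_prod_erase _ _ (Finset.mem_univ t), if_neg (by omega),
      Function.update_self, hR]
    congr 1
    refine Finset.prod_congr rfl fun l hl => ?_
    have hl' : l ≠ t := (Finset.mem_erase.1 hl).1
    have hl'' : (l : ℕ) ≠ t := fun h => hl' (Fin.ext h)
    rw [Function.update_of_ne hl']
    congr 1
    exact propext ⟨fun h => by omega, fun h => by omega⟩
  have hz0 : fftAmp (t + 1) x z = (if z t = x t then 1 else 0) * R := by
    rw [← hamp', Function.update_eq_self]
  -- The twiddle phase is computed from the bits below `t`, which still are input bits.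
  have hlow : R = 0 ∨ lowBits t z = lowBits t x := by
    by_cases h : ∀ l : Fin m, (l : ℕ) < t → z l = x l
    · right
      refine Finset.sum_congr rfl fun l _ => ?_
      split_ifs with hl
      · rw [h l hl]
      · rfl
    · left
      push Not at h
      obtain ⟨l, hl, hne⟩ := h
      refine Finset.prod_eq_zero (i := l) (Finset.mem_erase.2 ⟨?_, Finset.mem_univ l⟩) ?_
      · rintro rfl
        exact lt_irrefl _ hl
      · rw [if_neg (by omega), if_neg hne]
  rw [act_fftStage, hv, hv, hamp, hz0, flipBit, hamp', fftFactor]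
  rcases hlow with hR0 | hlow
  · simp [hR0]
  · rw [hlow]
    have hz : z t = 0 ∨ z t = 1 := by omega
    have hx : x t = 0 ∨ x t = 1 := by omega
    rcases hz with hz | hz <;> rcases hx with hx | hx
    · simp [hz, hx]
    · simp [hz, hx]
    · simp [hz, hx]
      ring
    · simp [hz, hx, mul_add, Complex.exp_add, Complex.exp_neg]
      ring

/-- The stages from the highest bit down to bit `t`. -/
lemma exists_stages (s t : ℕ) (hst : s + t = m) : ∃ W : Circuit (2 ^ m), W.Valid ∧
    W.depth = 3 * s ∧
    ∀ x z, W.act (Pi.single (bits m x) 1) (bits m z) = fftAmp t x z := by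
  induction s generalizing t with
  | zero =>
    refine ⟨[], fun L hL => by simp at hL, rfl, fun x z => ?_⟩
    have hlt : ∀ l : Fin m, ¬ t ≤ (l : ℕ) := fun l => by omega
    simp only [Circuit.act, List.foldl_nil, fftAmp, hlt, if_false]
    simp only [Pi.single_apply, (bits m).injective.eq_iff]
    split_ifs with h
    · simp [h]
    · obtain ⟨l, hl⟩ := Function.ne_iff.1 h
      exact (Finset.prod_eq_zero (Finset.mem_univ l) (if_neg hl)).symm
  | succ s ih =>
    obtain ⟨W, hW, hd, hact⟩ := ih (t + 1) (by omega)
    refine ⟨W ++ fftStage ⟨t, by omega⟩, hW.append (valid_fftStage _), ?_, fun x z => ?_⟩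
    · simp only [Circuit.depth, List.length_append] at hd ⊢
      rw [hd]
      simp [fftStage]
      ring
    · rw [Circuit.act_append]
      exact act_fftStage_fftAmp ⟨t, _⟩ x (hact x) z

/-- The amplitude after all stages is the Fourier transform with the output bits in the reverse
order. -/
lemma fftAmp_zero (x y : Fin m → Fin 2) :
    fftAmp 0 x (fun l => y l.rev) = dft (2 ^ m) (bits m y) (bits m x) := by
  have hy : ((bits m y : ℕ) : ℂ) =
      ∑ l : Fin m, ((y l.rev : ℕ) : ℂ) * (2 ^ m / 2 ^ ((l : ℕ) + 1)) := by
    rw [bits, finFunctionFinEquiv_apply, ← Equiv.sum_comp Fin.revPerm]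
    push_cast
    refine Finset.sum_congr rfl fun l _ => ?_
    rw [Fin.revPerm_apply, Fin.val_rev, eq_comm]
    congr 1
    rw [div_eq_iff (pow_ne_zero _ two_ne_zero), ← pow_add, Nat.sub_add_cancel (by omega)]
  have hx : ∀ l : Fin m, ∃ N : ℕ, (bits m x : ℕ) =
      lowBits l x + (x l : ℕ) * 2 ^ (l : ℕ) + 2 ^ ((l : ℕ) + 1) * N := by
    intro l
    -- The bits above position `l` form a multiple of `2 ^ (l + 1)`, an integer number of periods.
    refine ⟨∑ i : Fin m, if (i : ℕ) ≤ l then 0 else (x i : ℕ) * 2 ^ ((i : ℕ) - (l + 1)), ?_⟩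
    have h1 : (x l : ℕ) * 2 ^ (l : ℕ) =
        ∑ i : Fin m, if i = l then (x i : ℕ) * 2 ^ (i : ℕ) else 0 := by
      simp
    rw [bits, finFunctionFinEquiv_apply, lowBits, h1, Finset.mul_sum, ← Finset.sum_add_distrib,
      ← Finset.sum_add_distrib]
    refine Finset.sum_congr rfl fun i _ => ?_
    rcases lt_trichotomy (i : ℕ) l with h | h | h
    · have : i ≠ l := fun e => by rw [e] at h; exact lt_irrefl _ h
      simp [h, h.le, this]
    · have : i = l := Fin.ext h
      simp [this]
    · have : i ≠ l := fun e => by rw [e] at h; exact lt_irrefl _ h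
      rw [if_neg (by omega), if_neg this, if_neg (by omega), zero_add, zero_add, mul_left_comm,
        ← pow_add, Nat.add_sub_cancel' (by omega)]
  have hs : ((1 / Real.sqrt ((2 ^ m : ℕ) : ℝ) : ℝ) : ℂ) = ((√2 / 2 : ℝ) : ℂ) ^ m := by
    rw [← Complex.ofReal_pow]
    congr 1
    have h2 : Real.sqrt ((2 ^ m : ℕ) : ℝ) = √2 ^ m := by
      rw [Real.sqrt_eq_iff_mul_self_eq (by positivity) (by positivity), ← mul_pow,
        Real.mul_self_sqrt (by norm_num)]
      push_cast
      rfl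
    rw [h2, ← _root_.one_div_pow]
    congr 1
    rw [div_eq_div_iff (by positivity) (by norm_num), Real.mul_self_sqrt (by norm_num), one_mul]
  rw [dft, Matrix.of_apply, hs, fftAmp]
  simp only [zero_le, if_true, fftFactor]
  rw [Finset.prod_mul_distrib, Finset.prod_const, Finset.card_univ, Fintype.card_fin, hy]
  congr 1
  rw [Finset.mul_sum, Finset.sum_div, ← Finset.sum_neg_distrib, Complex.exp_sum]
  refine Finset.prod_congr rfl fun l _ => ?_
  obtain ⟨N, hN⟩ := hx l
  rw [hN, Complex.exp_eq_exp_iff_exists_int]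
  refine ⟨((y l.rev : ℕ) * N : ℕ), ?_⟩
  push_cast
  field_simp
  ring

/-- The last step of the fast Fourier transform: reversal of the bits, by swaps. A swap of two
modes is an interaction by the angle `π/2`, up to a phase `-i`. -/
def bitReversal (m : ℕ) : Circuit (2 ^ m) :=
  [phaseLayer fun d => if onSites (fun z l => z l.rev) d = d then 0 else -(Real.pi / 2),
    pairLayer (onSites fun z l => z l.rev) (Real.pi / 2)]

lemma involutive_rev : Function.Involutive fun (z : Fin m → Fin 2) (l : Fin m) => z l.rev := by
  intro z
  ext l
  simp

lemma valid_bitReversal : (bitReversal m).Valid := by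
  intro L hL
  simp only [bitReversal, List.mem_cons, List.not_mem_nil, or_false] at hL
  rcases hL with rfl | rfl
  · exact valid_phaseLayer _
  · exact valid_pairLayer (involutive_onSites involutive_rev) _

lemma act_bitReversal (v : Fin (2 ^ m) → ℂ) (d : Fin (2 ^ m)) :
    Circuit.act (bitReversal m) v d = v (onSites (fun z l => z l.rev) d) := by
  have hinv := involutive_onSites (m := m) involutive_rev
  simp only [bitReversal, Circuit.act, List.foldl_cons, List.foldl_nil]
  rw [layerAct_pairLayer hinv, layerAct_phaseLayer, layerAct_phaseLayer, hinv d]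
  by_cases h : onSites (fun z l => z l.rev) d = d
  · simp [h]
  · rw [if_neg h, if_neg (Ne.symm h), exp_neg_I_mul_neg_pi_div_two, Real.cos_pi_div_two,
      Real.sin_pi_div_two, ofReal_zero, ofReal_one]
    linear_combination (-v (onSites (fun z l => z l.rev) d)) * I_mul_I

theorem exists_fft_circuit (m : ℕ) : ∃ W : Circuit (2 ^ m), W.Valid ∧ W.depth = 3 * m + 2 ∧
    W.eval Gate.fermionOp = FFFT (2 ^ m) := by
  obtain ⟨W, hW, hd, hact⟩ := exists_stages (m := m) m 0 rfl
  refine ⟨W ++ bitReversal m, hW.append valid_bitReversal, ?_,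
    Circuit.eval_eq_FFFT (hW.append valid_bitReversal) fun c k => ?_⟩
  · simp only [Circuit.depth, List.length_append] at hd ⊢
    rw [hd]
    rfl
  · obtain ⟨x, rfl⟩ := (bits m).surjective c
    obtain ⟨y, rfl⟩ := (bits m).surjective k
    rw [Circuit.act_append, act_bitReversal, onSites_bits, hact, fftAmp_zero]

end

end XYRing

/-! ### Exact diagonalization and logarithmic depth -/

theorem mainTheorem4 :
    -- The exact diagonalization, for every ring of at least two qubits.
    (∀ κ : ℕ, 2 ≤ κ →
      -- Jordan–Wigner: fermionic operators, with number operators `(1 - σᶻ)/2`.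
      IsCAR (ann : Fin κ → Op κ) ∧
      (∀ c : Fin κ, (ann c)ᴴ * ann c = occupation c) ∧
      -- The `XY` ring as a quadratic fermionic Hamiltonian with the gauge operator in the
      -- boundary term, hence periodic in the sector of odd parity.
      (∀ first last : Fin κ, (first : ℕ) = 0 → (last : ℕ) + 1 = κ →
        xyRing κ = (∑ c ∈ Finset.univ.erase last, hop c (next c)) -
          ((ann last)ᴴ * ann first * parity κ + ((ann last)ᴴ * ann first * parity κ)ᴴ)) ∧
      (∀ ψ : State κ, IsOdd ψ → xyRing κ *ᵥ ψ = fermionRing κ *ᵥ ψ) ∧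
      -- The momentum modes diagonalize it with energies `E_k = 2 cos (2πk/κ)`.
      IsCAR (mode : Fin κ → Op κ) ∧
      fermionRing κ = ∑ k : Fin κ, ((energy k : ℝ) : ℂ) • ((mode k)ᴴ * mode k) ∧
      -- The fermionic Fourier transform is the unitary that implements this change of modes,
      FFFT κ ∈ Matrix.unitaryGroup (Fin κ → Fin 2) ℂ ∧
      FFFT κ *ᵥ vacuum κ = vacuum κ ∧
      (∀ k : Fin κ, (FFFT κ)ᴴ * ann k * FFFT κ = mode k) ∧
      FFFT κ * fermionRing κ * (FFFT κ)ᴴ = ∑ k : Fin κ, ((energy k : ℝ) : ℂ) • occupation k ∧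
      -- and the evolution is the transform, single-qubit `Z` rotations, the inverse transform.
      (∀ β : ℝ, evolve β (fermionRing κ) =
        (FFFT κ)ᴴ * Circuit.eval Gate.qubitOp [rotLayer κ β] * FFFT κ) ∧
      (∀ (β : ℝ) (ψ : State κ), IsOdd ψ → evolve β (xyRing κ) *ᵥ ψ =
        ((FFFT κ)ᴴ * Circuit.eval Gate.qubitOp [rotLayer κ β] * FFFT κ) *ᵥ ψ)) ∧
    -- Logarithmic depth, for ring sizes that are powers of two.
    (∃ C : ℝ, ∀ m κ : ℕ, 1 ≤ m → κ = 2 ^ m →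
      ∃ W : Circuit κ,
        Circuit.Valid W ∧
        (Circuit.depth W : ℝ) ≤ C * Real.log κ ∧
        -- `W` is the fermionic Fourier transform: on the whole Fock space with two-mode gates,
        -- on the feasible subspace with two-qubit gates.
        Circuit.eval Gate.fermionOp W = FFFT κ ∧
        (∀ ψ : State κ, IsFeasible ψ →
          Circuit.eval Gate.qubitOp W *ᵥ ψ = FFFT κ *ᵥ ψ) ∧
        -- `W`, `Z` rotations, `W†` is the exact mixer.
        (∀ β : ℝ,
          Circuit.Valid (mixer W β) ∧
          (Circuit.depth (mixer W β) : ℝ) ≤ C * Real.log κ ∧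
          (∀ ψ : State κ, IsOdd ψ →
            Circuit.eval Gate.fermionOp (mixer W β) *ᵥ ψ = evolve β (xyRing κ) *ᵥ ψ) ∧
          (∀ ψ : State κ, IsFeasible ψ →
            Circuit.eval Gate.qubitOp (mixer W β) *ᵥ ψ = evolve β (xyRing κ) *ᵥ ψ))) := by
  refine ⟨fun κ hκ => ⟨isCAR_ann, ann_conjTranspose_mul_self, fun first last h0 hl =>
    xyRing_eq hκ h0 hl, fun ψ hψ => xyRing_mulVec_of_isOdd hκ hψ, isCAR_mode, fermionRing_eq,
    ?_, FFFT_mulVec_vacuum, FFFT_conj_ann, FFFT_conj_fermionRing, evolve_fermionRing,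
    fun β ψ hψ => ?_⟩, 11 / Real.log 2, ?_⟩
  · rw [mem_unitaryGroup_iff]
    exact FFFT_mul_conjTranspose_self
  · rw [evolve_xyRing_of_isOdd hκ β hψ, evolve_fermionRing]
  -- The mixer has depth `2 (3 m + 2) + 1 ≤ 11 m`, and `m = log κ / log 2`.
  · rintro m κ hm rfl
    obtain ⟨W, hW, hd, heval⟩ := exists_fft_circuit m
    have hκ : 2 ≤ 2 ^ m := Nat.le_self_pow (by omega) 2
    have hlog : 11 / Real.log 2 * Real.log ((2 ^ m : ℕ) : ℝ) = 11 * m := by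
      have : Real.log 2 ≠ 0 := (Real.log_pos (by norm_num)).ne'
      push_cast
      rw [Real.log_pow]
      field_simp
    have hm' : (1 : ℝ) ≤ m := by exact_mod_cast hm
    refine ⟨W, hW, ?_, heval, fun ψ hψ => ?_, fun β => ⟨valid_mixer hW β, ?_, fun ψ hψ => ?_,
      fun ψ hψ => ?_⟩⟩
    · rw [hlog, hd]
      push_cast
      linarith
    · rw [Circuit.eval_qubitOp_mulVec hW hψ, heval]
    · rw [hlog, depth_mixer, hd]
      push_cast
      linarith
    · rw [eval_fermionOp_mixer hW heval, evolve_xyRing_of_isOdd hκ β hψ]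
    · rw [Circuit.eval_qubitOp_mulVec (valid_mixer hW β) hψ, eval_fermionOp_mixer hW heval,
        evolve_xyRing_of_isOdd hκ β hψ.isOdd]
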